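/- Let $\mathbb F$ be an algebraically closed field with $\operatorname{char}\mathbb F\neq 2$, and $G_n=GL_n(\mathbb F)$, with $G_n\times G_1\subset G_{n+1}$ block diagonally. For a finite-dimensional polynomial representation $V$ of $G_{n+1}$ and $i\in\mathbb Z$ let $R_i(V)$ be the subspace of weight $i$ for $G_1$, a polynomial representation of $G_n$. Let $s_n\in G_{n+1}$ ($n\ge 1$) be the block diagonal matrix $\operatorname{diag}\big(1,\dots,1,\begin{pmatrix}0&-1\\1&0\end{pmatrix}\big)$. Let $\mathcal M$ be the category whose objects are sequences $V=(V_n,\alpha_n)_{n\ge 0}$, where $V_n$ is a finite-dimensional polynomial representation of $G_n$ and $\alpha_n:R_0(V_{n+1})\to V_n$ is an isomorphism of $G_n$-modules, such that only finitely many of the homogeneous components $V(k)=(V_n(k))_n$ are nonzero (here $V_n(k)$ is the subspace on which the scalar matrices $z$ act by $z^k$). The morphisms $(V_n,\alpha_n)\to(W_n,\beta_n)$ are the sequences of $G_n$-morphisms $f_n:V_n\to W_n$ with $f_n\circ\alpha_n=\beta_n\circ R_0(f_{n+1})$ for all $n$, i.e. the elements of $\varprojlim \operatorname{Hom}_{G_n}(V_n,W_n)$.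 Let $E:\mathcal M\to\mathcal M$ be the functor with $E(V)_n=R_1(V_{n+1})$, gluing maps $R_1(\alpha_{n+1})\circ s_{n+1}^{-1}$, and $E(f)_n=R_1(f_{n+1})$. Let $\bar H_m$ be the degenerate affine Hecke algebra of $GL_m$ over $\mathbb Z$: the ring generated by the polynomial ring $\mathbb Z[y_1,\dots,y_m]$ and the group ring $\mathbb Z\mathfrak S_m$ subject to $$\tau_i y_j=y_j\tau_i\quad(j\neq i,i+1),\qquad \tau_i y_{i+1}-y_i\tau_i=1,$$ where $\tau_1,\dots,\tau_{m-1}$ are the simple transpositions. **Proposition.** The operators $X_n=\sum_{i=1}^n x_{n+1,i}x_{i,n+1}-n$ on $R_1(V_{n+1})$, where $x_{i,j}$ are the matrix units of $\mathfrak{gl}_{n+1}$ acting by the differentiated representation, define a natural transformation $X:E\to E$; the actions of $s_{n+1}$ on $R_1(R_1(V_{n+2}))$ define a natural transformation $T:E^2\to E^2$; and $$T^2=1,\qquad T\circ XE-EX\circ T=1\quad\text{in } \operatorname{End}(E^2).$$ Moreover, for every $m\ge 0$ there is a ring homomorphism $\bar H_m\to\operatorname{End}(E^m)$ with $$y_i\mapsto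 E^{m-i}XE^{i-1}\ (1\le i\le m),\qquad \tau_i\mapsto E^{m-i-1}TE^{i-1}\ (1\le i\le m-1).$$ -/

import Mathlib

open CategoryTheory

universe u v

noncomputable section

namespace PolyFock

variable {F : Type u} [Field F]

/-! ### General linear groups -/

/-- The block diagonal embedding `(A, B) ↦ diag(A, B)` on matrices. -/
def blockMat (n k : ℕ) :
    Matrix (Fin n) (Fin n) F × Matrix (Fin k) (Fin k) F →* Matrix (Fin (n + k)) (Fin (n + k)) F where
  toFun p := Matrix.reindex finSumFinEquiv finSumFinEquiv (Matrix.fromBlocks p.1 0 0 p.2)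
  map_one' := by simp
  map_mul' p q := by
    simp [Matrix.submatrix_mul_equiv, Matrix.fromBlocks_multiply]

/-- The embedding `G_n × G_k ⊆ G_{n+k}` as block diagonal matrices. -/
def blockGL (n k : ℕ) : GL (Fin n) F × GL (Fin k) F →* GL (Fin (n + k)) F :=
  (Units.map (blockMat n k)).comp MulEquiv.prodUnits.symm.toMonoidHom

/-- The scalar matrices, i.e. the center of `G_n`. -/
def scalarGL (n : ℕ) : Fˣ →* GL (Fin n) F :=
  Units.map (Matrix.scalar (Fin n)).toMonoidHom

/-- The standard embedding `G_n ⊆ G_{n+1}`, as the automorphisms which act on the span of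
`v_1, …, v_n` and fix `v_{n+1}`. -/
def incl (n : ℕ) : GL (Fin n) F →* GL (Fin (n + 1)) F :=
  (blockGL n 1).comp (MonoidHom.inl _ _)

/-- The copy of `G_1` in `G_{n+1}` acting on the last basis vector `v_{n+1}`. -/
def lastTorus (n : ℕ) : Fˣ →* GL (Fin (n + 1)) F :=
  (blockGL n 1).comp ((MonoidHom.inr _ _).comp (scalarGL 1))

/-- The `2 × 2` matrix `[[0, -1], [1, 0]]`. -/
def rot : GL (Fin 2) F where
  val := !![0, -1; 1, 0]
  inv := !![0, 1; -1, 0]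
  val_inv := by simp [Matrix.one_fin_two]
  inv_val := by simp [Matrix.one_fin_two]

/-- The element `s_{n+1} = diag(1, …, 1, [[0, -1], [1, 0]])` of `G_{n+2}`. -/
def sElt (n : ℕ) : GL (Fin (n + 2)) F :=
  blockGL n 2 (1, rot)

/-! ### Polynomial representations -/

/-- A representation of `G_n` is polynomial if all its matrix coefficients extend to polynomial
functions on the space of `n × n` matrices. -/
def IsPolynomialRep {n : ℕ} {V : Type v} [AddCommGroup V] [Module F V]
    (ρ : Representation F (GL (Fin n) F) V) : Prop :=
  ∀ (φ : Module.Dual F V) (x : V), ∃ P : MvPolynomial (Fin n × Fin n) F,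
    ∀ g : GL (Fin n) F, φ (ρ g x) = MvPolynomial.eval (fun ij => g.val ij.1 ij.2) P

variable (F) in
/-- The objects of the category of finite dimensional polynomial representations of `G_n`. Its
morphisms are the `G_n`-equivariant linear maps, `Representation.IntertwiningMap`. -/
structure PolyRep (n : ℕ) where
  /-- the underlying vector space -/
  carrier : Type v
  [addCommGroup : AddCommGroup carrier]
  [module : Module F carrier]
  [finite : Module.Finite F carrier]
  /-- the action of `G_n` -/
  ρ : Representation F (GL (Fin n) F) carrier
  polynomial : IsPolynomialRep ρ

attribute [instance] PolyRep.addCommGroup PolyRep.module PolyRep.finite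

namespace PolyRep

/-- The degree `k` part of a representation of `G_n`, on which the scalar matrix `z` acts
by `z ^ k`. -/
def degreePart {n : ℕ} (V : PolyRep.{u, v} F n) (k : ℤ) : Submodule F V.carrier where
  carrier := {x | ∀ z : Fˣ, V.ρ (scalarGL n z) x = ((z ^ k : Fˣ) : F) • x}
  add_mem' hx hy z := by rw [map_add, hx z, hy z, smul_add]
  zero_mem' z := by simp
  smul_mem' c x hx z := by rw [map_smul, hx z, smul_comm]

/-! #### The differentiated action of the Lie algebra of `n × n` matrices -/

/-- The derivative of the polynomial function `P` at the identity matrix in the direction `A`. -/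
def derivAtOne {n : ℕ} (A : Matrix (Fin n) (Fin n) F) (P : MvPolynomial (Fin n × Fin n) F) : F :=
  ∑ ij : Fin n × Fin n, A ij.1 ij.2 *
    MvPolynomial.eval (fun kl => (1 : Matrix (Fin n) (Fin n) F) kl.1 kl.2)
      (MvPolynomial.pderiv ij P)

/-- The polynomial on `n × n` matrices which extends the matrix coefficient `g ↦ φ (g x)`. -/
def coeffPoly {n : ℕ} (V : PolyRep.{u, v} F n) (φ : Module.Dual F V.carrier) (x : V.carrier) :
    MvPolynomial (Fin n × Fin n) F :=
  (V.polynomial φ x).choose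

/-- The action of `A ∈ 𝔤𝔩_n` on a polynomial representation of `G_n`: the derivative at the
identity, in the direction `A`, of the action of `G_n`. It is written in a basis; it does not
depend on the basis by `lieAct_spec`. -/
def lieAct {n : ℕ} (V : PolyRep.{u, v} F n) (A : Matrix (Fin n) (Fin n) F) :
    Module.End F V.carrier :=
  Matrix.toLin (Module.finBasis F V.carrier) (Module.finBasis F V.carrier)
    (Matrix.of fun k j => derivAtOne A
      (V.coeffPoly ((Module.finBasis F V.carrier).coord k) (Module.finBasis F V.carrier j)))

theorem eq_of_eval_GL [Infinite F] {n : ℕ} {P Q : MvPolynomial (Fin n × Fin n) F}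
    (h : ∀ g : GL (Fin n) F, MvPolynomial.eval (fun ij => g.val ij.1 ij.2) P =
      MvPolynomial.eval (fun ij => g.val ij.1 ij.2) Q) : P = Q := by
  have key : (P - Q) * (Matrix.mvPolynomialX (Fin n) (Fin n) F).det = 0 := by
    refine MvPolynomial.funext fun x => ?_
    rw [map_mul, Matrix.eval_det_mvPolynomialX, map_zero]
    by_cases hd : (Matrix.of fun i j => x (i, j)).det = 0
    · rw [hd, mul_zero]
    · have := h (Matrix.GeneralLinearGroup.mkOfDetNeZero _ hd)
      have hx : (fun ij : Fin n × Fin n =>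
          (Matrix.GeneralLinearGroup.mkOfDetNeZero _ hd).val ij.1 ij.2) = x := rfl
      rw [hx] at this
      rw [map_sub, this, sub_self, zero_mul]
  rcases mul_eq_zero.1 key with h0 | h0
  · exact sub_eq_zero.1 h0
  · exact absurd h0 (Matrix.det_mvPolynomialX_ne_zero _ _)

/-- The Lie algebra action is the derivative of every matrix coefficient. -/
theorem lieAct_spec [Infinite F] {n : ℕ} (V : PolyRep.{u, v} F n) (A : Matrix (Fin n) (Fin n) F)
    (φ : Module.Dual F V.carrier) (x : V.carrier) (P : MvPolynomial (Fin n × Fin n) F)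
    (hP : ∀ g : GL (Fin n) F, φ (V.ρ g x) = MvPolynomial.eval (fun ij => g.val ij.1 ij.2) P) :
    φ (V.lieAct A x) = derivAtOne A P := by
  set b := Module.finBasis F V.carrier with hb
  have hlin : ∀ (ι : Type) (s : Finset ι) (c : ι → F) (Q : ι → MvPolynomial (Fin n × Fin n) F),
      derivAtOne A (∑ i ∈ s, MvPolynomial.C (c i) * Q i) = ∑ i ∈ s, c i * derivAtOne A (Q i) := by
    intro ι s c Q
    simp only [derivAtOne, map_sum, map_mul, MvPolynomial.pderiv_C_mul, MvPolynomial.eval_C,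
      Finset.mul_sum]
    rw [Finset.sum_comm]
    refine Finset.sum_congr rfl fun i _ => Finset.sum_congr rfl fun ij _ => by ring
  have hPQ : P = ∑ kj : Fin _ × Fin _, MvPolynomial.C (φ (b kj.1) * b.repr x kj.2) *
      V.coeffPoly (b.coord kj.1) (b kj.2) := by
    refine eq_of_eval_GL fun g => ?_
    rw [← hP g]
    simp only [map_sum, map_mul, MvPolynomial.eval_C]
    have : ∀ kj : Fin _ × Fin _, MvPolynomial.eval (fun ij => g.val ij.1 ij.2)
        (V.coeffPoly (b.coord kj.1) (b kj.2)) = b.coord kj.1 (V.ρ g (b kj.2)) :=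
      fun kj => ((V.polynomial (b.coord kj.1) (b kj.2)).choose_spec g).symm
    simp only [this]
    conv_lhs => rw [← b.sum_repr x, map_sum, map_sum]
    rw [Fintype.sum_prod_type_right]
    refine Finset.sum_congr rfl fun j _ => ?_
    conv_lhs => rw [map_smul, map_smul, ← b.sum_repr (V.ρ g (b j)), map_sum, Finset.smul_sum]
    refine Finset.sum_congr rfl fun k _ => ?_
    simp only [map_smul, smul_eq_mul, Module.Basis.coord_apply]
    ring
  rw [hPQ, hlin, Fintype.sum_prod_type_right]
  conv_lhs => rw [← b.sum_repr x, map_sum, map_sum]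
  refine Finset.sum_congr rfl fun j _ => ?_
  rw [map_smul, map_smul, lieAct, ← hb, Matrix.toLin_self, map_sum, Finset.smul_sum]
  refine Finset.sum_congr rfl fun k _ => ?_
  simp only [map_smul, smul_eq_mul, Matrix.of_apply]
  ring

/-- The operator `X_n = ∑_{i ≤ n} x_{n+1,i} x_{i,n+1} - n` on a polynomial representation of
`G_{n+1}`, where the `x_{i,j}` are the matrix units of `𝔤𝔩_{n+1}`. -/
def opX {n : ℕ} (V : PolyRep.{u, v} F (n + 1)) : Module.End F V.carrier :=
  ∑ i : Fin n, V.lieAct (Matrix.single (Fin.last n) i.castSucc 1) *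
    V.lieAct (Matrix.single i.castSucc (Fin.last n) 1) - (n : F) • 1

/-! #### The functors `R_i` -/

/-- The vectors of weight `i` for the copy of `G_1` in `G_{n+1}` acting on `v_{n+1}`. -/
def weightSpace {n : ℕ} (i : ℤ) (V : PolyRep.{u, v} F (n + 1)) : Submodule F V.carrier where
  carrier := {x | ∀ t : Fˣ, V.ρ (lastTorus n t) x = ((t ^ i : Fˣ) : F) • x}
  add_mem' hx hy t := by rw [map_add, hx t, hy t, smul_add]
  zero_mem' t := by simp
  smul_mem' c x hx t := by rw [map_smul, hx t, smul_comm]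

theorem incl_mul_lastTorus {n : ℕ} (g : GL (Fin n) F) (t : Fˣ) :
    incl n g * lastTorus n t = lastTorus n t * incl n g := by
  simp only [incl, lastTorus, MonoidHom.comp_apply, ← map_mul]
  simp

theorem incl_mem {n : ℕ} (i : ℤ) (V : PolyRep.{u, v} F (n + 1)) (g : GL (Fin n) F) :
    ∀ x ∈ V.weightSpace i, V.ρ (incl n g) x ∈ V.weightSpace i := by
  intro x hx t
  rw [← Module.End.mul_apply, ← map_mul, ← incl_mul_lastTorus, map_mul, Module.End.mul_apply,
    hx t, map_smul]

theorem polynomial_res {n : ℕ} (V : PolyRep.{u, v} F (n + 1)) (W : Submodule F V.carrier)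
    (φ : Module.Dual F W) (x : W) (h : ∀ g : GL (Fin n) F, V.ρ (incl n g) x ∈ W) :
    ∃ P : MvPolynomial (Fin n × Fin n) F, ∀ g : GL (Fin n) F,
      φ ⟨V.ρ (incl n g) x, h g⟩ = MvPolynomial.eval (fun ij => g.val ij.1 ij.2) P := by
  obtain ⟨ψ, hψ⟩ := LinearMap.exists_extend φ
  obtain ⟨P, hP⟩ := V.polynomial ψ x
  refine ⟨MvPolynomial.aeval (fun ij : Fin (n + 1) × Fin (n + 1) =>
    Matrix.reindex finSumFinEquiv finSumFinEquiv (Matrix.fromBlocks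
      (Matrix.mvPolynomialX (Fin n) (Fin n) F) 0 0 (1 : Matrix (Fin 1) (Fin 1) _)) ij.1 ij.2) P,
    fun g => ?_⟩
  have h1 : φ ⟨V.ρ (incl n g) x, h g⟩ = ψ (V.ρ (incl n g) x) := by rw [← hψ]; rfl
  rw [h1, hP]
  rw [← MvPolynomial.coe_aeval_eq_eval, ← MvPolynomial.coe_aeval_eq_eval]
  simp only [RingHom.coe_coe]
  rw [← AlgHom.comp_apply, MvPolynomial.comp_aeval]
  congr 2
  funext ij
  obtain ⟨a, b⟩ := ij
  obtain ⟨a, rfl⟩ := finSumFinEquiv.surjective a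
  obtain ⟨b, rfl⟩ := finSumFinEquiv.surjective b
  have h2 : (incl n g).val = Matrix.reindex finSumFinEquiv finSumFinEquiv
      (Matrix.fromBlocks g.val 0 0 1) := rfl
  rw [h2]
  simp only [Matrix.reindex_apply, Matrix.submatrix_apply, Equiv.symm_apply_apply]
  rcases a with a | a <;> rcases b with b | b <;>
    simp [Matrix.fromBlocks, Matrix.mvPolynomialX, Matrix.one_apply]

/-- The functor `R_i` on objects: the `i`-th weight space of `G_1`, with the action of
`G_n ⊆ G_{n+1}`. -/
def R {n : ℕ} (i : ℤ) (V : PolyRep.{u, v} F (n + 1)) : PolyRep.{u, v} F n where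
  carrier := V.weightSpace i
  ρ :=
    { toFun := fun g => (V.ρ (incl n g)).restrict (V.incl_mem i g)
      map_one' := by ext x; simp
      map_mul' := fun g h => by ext x; simp [map_mul] }
  polynomial φ x := V.polynomial_res (V.weightSpace i) φ x (fun g => V.incl_mem i g x x.2)

/-- The inclusion of `R_i V` into `V`. -/
def inclR {n : ℕ} (i : ℤ) (V : PolyRep.{u, v} F (n + 1)) : (V.R i).carrier →ₗ[F] V.carrier :=
  (V.weightSpace i).subtype

/-- The functor `R_i` on morphisms: restriction to the weight spaces. -/
def mapR {n : ℕ} (i : ℤ) {V W : PolyRep.{u, v} F (n + 1)}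
    (f : Representation.IntertwiningMap V.ρ W.ρ) :
    Representation.IntertwiningMap (V.R i).ρ (W.R i).ρ where
  toLinearMap := f.toLinearMap.restrict (p := V.weightSpace i) (q := W.weightSpace i)
    (fun x hx t => by
      rw [Representation.IntertwiningMap.toLinearMap_apply,
        ← Representation.IntertwiningMap.isIntertwining, hx t, map_smul])
  isIntertwining' g := by
    refine LinearMap.ext fun x => Subtype.ext ?_
    exact Representation.IntertwiningMap.isIntertwining _ _ f (incl n g) x.1

/-- The functor `R_i` on isomorphisms. -/
def equivR {n : ℕ} (i : ℤ) {V W : PolyRep.{u, v} F (n + 1)} (e : V.ρ.Equiv W.ρ) :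
    (V.R i).ρ.Equiv (W.R i).ρ where
  toIntertwiningMap := mapR i e.toIntertwiningMap
  invFun := mapR i e.symm.toIntertwiningMap
  left_inv x := Subtype.ext (e.symm_apply_apply x.1)
  right_inv x := Subtype.ext (e.apply_symm_apply x.1)

/-! #### The action of `s_{n+1}` on iterated weight spaces -/

theorem blockGL_val {n k : ℕ} (p : GL (Fin n) F × GL (Fin k) F) :
    (blockGL n k p).val = Matrix.reindex finSumFinEquiv finSumFinEquiv
      (Matrix.fromBlocks p.1.val 0 0 p.2.val) := rfl

theorem blockGL_cc {n k : ℕ} (p : GL (Fin n) F × GL (Fin k) F) (i j : Fin n) :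
    (blockGL n k p).val (Fin.castAdd k i) (Fin.castAdd k j) = p.1.val i j := by
  simp [blockGL_val]

theorem blockGL_nn {n k : ℕ} (p : GL (Fin n) F × GL (Fin k) F) (i j : Fin k) :
    (blockGL n k p).val (Fin.natAdd n i) (Fin.natAdd n j) = p.2.val i j := by
  simp [blockGL_val]

theorem blockGL_cn {n k : ℕ} (p : GL (Fin n) F × GL (Fin k) F) (i : Fin n) (j : Fin k) :
    (blockGL n k p).val (Fin.castAdd k i) (Fin.natAdd n j) = 0 := by
  simp [blockGL_val]

theorem blockGL_nc {n k : ℕ} (p : GL (Fin n) F × GL (Fin k) F) (i : Fin k) (j : Fin n) :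
    (blockGL n k p).val (Fin.natAdd n i) (Fin.castAdd k j) = 0 := by
  simp [blockGL_val]

/-- `diag(diag(A, B), C) = diag(A, diag(B, C))`. -/
theorem blockGL_assoc (n : ℕ) (g : GL (Fin n) F) (h k : GL (Fin 1) F) :
    blockGL (n + 1) 1 (blockGL n 1 (g, h), k) = blockGL n 2 (g, blockGL 1 1 (h, k)) := by
  apply Units.ext
  ext i j
  induction i using Fin.addCases (m := n) (n := 2) with
  | left i =>
    induction j using Fin.addCases (m := n) (n := 2) with
    | left j =>
      rw [blockGL_cc]
      exact (blockGL_cc (n := n + 1) (k := 1) _ (Fin.castAdd 1 i) (Fin.castAdd 1 j)).trans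
        (blockGL_cc _ _ _)
    | right j =>
      rw [blockGL_cn]
      revert j
      refine Fin.forall_fin_two.2 ⟨?_, ?_⟩
      · exact (blockGL_cc (n := n + 1) (k := 1) _ (Fin.castAdd 1 i) (Fin.natAdd n 0)).trans
          (blockGL_cn _ _ _)
      · exact blockGL_cn (n := n + 1) (k := 1) _ (Fin.castAdd 1 i) 0
  | right i =>
    induction j using Fin.addCases (m := n) (n := 2) with
    | left j =>
      rw [blockGL_nc]
      revert i
      refine Fin.forall_fin_two.2 ⟨?_, ?_⟩
      · exact (blockGL_cc (n := n + 1) (k := 1) _ (Fin.natAdd n 0) (Fin.castAdd 1 j)).trans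
          (blockGL_nc _ _ _)
      · exact blockGL_nc (n := n + 1) (k := 1) _ 0 (Fin.castAdd 1 j)
    | right j =>
      rw [blockGL_nn]
      revert i j
      refine Fin.forall_fin_two.2 ⟨Fin.forall_fin_two.2 ⟨?_, ?_⟩,
        Fin.forall_fin_two.2 ⟨?_, ?_⟩⟩
      · exact ((blockGL_cc (n := n + 1) (k := 1) _ (Fin.natAdd n 0) (Fin.natAdd n 0)).trans
          (blockGL_nn _ _ _)).trans (blockGL_cc (n := 1) (k := 1) (h, k) 0 0).symm
      · exact (blockGL_cn (n := n + 1) (k := 1) _ (Fin.natAdd n 0) 0).trans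
          (blockGL_cn (n := 1) (k := 1) (h, k) 0 0).symm
      · exact (blockGL_nc (n := n + 1) (k := 1) _ 0 (Fin.natAdd n 0)).trans
          (blockGL_nc (n := 1) (k := 1) (h, k) 0 0).symm
      · exact (blockGL_nn (n := n + 1) (k := 1) _ 0 0).trans
          (blockGL_nn (n := 1) (k := 1) (h, k) 0 0).symm

theorem lastTorus_eq (n : ℕ) (t : Fˣ) :
    lastTorus (n + 1) t = blockGL n 2 (1, blockGL 1 1 (1, scalarGL 1 t)) := by
  rw [← blockGL_assoc, ← Prod.one_eq_mk, map_one]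
  rfl

theorem incl_lastTorus_eq (n : ℕ) (t : Fˣ) :
    incl (n + 1) (lastTorus n t) = blockGL n 2 (1, blockGL 1 1 (scalarGL 1 t, 1)) := by
  rw [← blockGL_assoc]
  rfl

theorem incl_incl_eq (n : ℕ) (g : GL (Fin n) F) :
    incl (n + 1) (incl n g) = blockGL n 2 (g, 1) := by
  have := blockGL_assoc n g 1 1
  rw [← Prod.one_eq_mk, map_one] at this
  rw [← this]
  rfl

theorem scalarGL_succ (n : ℕ) (z : Fˣ) :
    scalarGL (n + 1) z = lastTorus n z * incl n (scalarGL n z) := by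
  have h : lastTorus n z * incl n (scalarGL n z) = blockGL n 1 (scalarGL n z, scalarGL 1 z) := by
    simp only [incl, lastTorus, MonoidHom.comp_apply, ← map_mul]
    simp
  rw [h]
  apply Units.ext
  ext i j
  induction i using Fin.addCases with
  | left i =>
    induction j using Fin.addCases with
    | left j =>
      rw [blockGL_cc]
      simp [scalarGL, Matrix.diagonal_apply]
    | right j =>
      rw [blockGL_cn]
      simp [scalarGL, Matrix.diagonal_apply, Fin.ext_iff]
      omega
  | right i =>
    induction j using Fin.addCases with
    | left j =>
      rw [blockGL_nc]
      simp [scalarGL, Matrix.diagonal_apply, Fin.ext_iff]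
      omega
    | right j =>
      rw [blockGL_nn]
      simp [scalarGL, Matrix.diagonal_apply, Fin.ext_iff]

theorem blockGL_one_one (h k : GL (Fin 1) F) :
    (blockGL 1 1 (h, k)).val = !![h.val 0 0, 0; 0, k.val 0 0] := by
  ext i j
  revert i j
  refine Fin.forall_fin_two.2 ⟨Fin.forall_fin_two.2 ⟨?_, ?_⟩, Fin.forall_fin_two.2 ⟨?_, ?_⟩⟩
  · exact blockGL_cc (n := 1) (k := 1) (h, k) 0 0
  · exact blockGL_cn (n := 1) (k := 1) (h, k) 0 0
  · exact blockGL_nc (n := 1) (k := 1) (h, k) 0 0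
  · exact blockGL_nn (n := 1) (k := 1) (h, k) 0 0

theorem rot_mul (h k : GL (Fin 1) F) :
    rot * blockGL 1 1 (h, k) = blockGL 1 1 (k, h) * rot := by
  apply Units.ext
  rw [Units.val_mul, Units.val_mul, blockGL_one_one, blockGL_one_one]
  simp [rot]

theorem sElt_mul_outer (n : ℕ) (t : Fˣ) :
    sElt n * lastTorus (n + 1) t = incl (n + 1) (lastTorus n t) * sElt n := by
  rw [lastTorus_eq, incl_lastTorus_eq, sElt, ← map_mul, ← map_mul, Prod.mk_mul_mk, Prod.mk_mul_mk,
    rot_mul]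

theorem sElt_mul_inner (n : ℕ) (t : Fˣ) :
    sElt n * incl (n + 1) (lastTorus n t) = lastTorus (n + 1) t * sElt n := by
  rw [lastTorus_eq, incl_lastTorus_eq, sElt, ← map_mul, ← map_mul, Prod.mk_mul_mk, Prod.mk_mul_mk,
    rot_mul]

theorem sElt_mul_incl (n : ℕ) (g : GL (Fin n) F) :
    sElt n * incl (n + 1) (incl n g) = incl (n + 1) (incl n g) * sElt n := by
  rw [incl_incl_eq, sElt, ← map_mul, ← map_mul, Prod.mk_mul_mk, Prod.mk_mul_mk, one_mul, mul_one,
    one_mul, mul_one]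

theorem inv_mul_of {G : Type*} [Group G] {s a b : G} (h : s * a = b * s) :
    s⁻¹ * b = a * s⁻¹ := by
  rw [inv_mul_eq_iff_eq_mul, ← mul_assoc, h, mul_assoc, mul_inv_cancel, mul_one]

/-- An element of `G_{n+2}` which commutes with `G_n` and interchanges the last two coordinate
subgroups `G_1` maps `R_a (R_b V)` to `R_b (R_a V)`. -/
def swapMap {n : ℕ} (V : PolyRep.{u, v} F (n + 2)) (a b : ℤ) (s : GL (Fin (n + 2)) F)
    (h1 : ∀ t : Fˣ, s * lastTorus (n + 1) t = incl (n + 1) (lastTorus n t) * s)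
    (h2 : ∀ t : Fˣ, s * incl (n + 1) (lastTorus n t) = lastTorus (n + 1) t * s)
    (h3 : ∀ g : GL (Fin n) F, s * incl (n + 1) (incl n g) = incl (n + 1) (incl n g) * s) :
    Representation.IntertwiningMap ((V.R b).R a).ρ ((V.R a).R b).ρ where
  toFun x := ⟨⟨V.ρ s x.1.1, fun t => by
      have hx := congrArg Subtype.val (x.2 t)
      change V.ρ (incl (n + 1) (lastTorus n t)) x.1.1 = _ • x.1.1 at hx
      rw [← Module.End.mul_apply, ← map_mul, ← h2, map_mul, Module.End.mul_apply, hx, map_smul]⟩,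
    fun t => Subtype.ext <| by
      change V.ρ (incl (n + 1) (lastTorus n t)) (V.ρ s x.1.1) = _ • V.ρ s x.1.1
      rw [← Module.End.mul_apply, ← map_mul, ← h1, map_mul, Module.End.mul_apply, x.1.2 t,
        map_smul]⟩
  map_add' x y := Subtype.ext (Subtype.ext (map_add (V.ρ s) _ _))
  map_smul' c x := Subtype.ext (Subtype.ext (map_smul (V.ρ s) _ _))
  isIntertwining' g := LinearMap.ext fun x => Subtype.ext <| Subtype.ext <| by
    change V.ρ s (V.ρ (incl (n + 1) (incl n g)) x.1.1) =
      V.ρ (incl (n + 1) (incl n g)) (V.ρ s x.1.1)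
    rw [← Module.End.mul_apply, ← map_mul, h3, map_mul, Module.End.mul_apply]

/-- The isomorphism `R_a (R_b V) ≅ R_b (R_a V)`, for `V` a polynomial representation of `G_{n+2}`,
given by the action of `s_{n+1}`. -/
def swap {n : ℕ} (V : PolyRep.{u, v} F (n + 2)) (a b : ℤ) :
    ((V.R b).R a).ρ.Equiv ((V.R a).R b).ρ where
  toIntertwiningMap := V.swapMap a b (sElt n) (sElt_mul_outer n) (sElt_mul_inner n)
    (sElt_mul_incl n)
  invFun := V.swapMap b a (sElt n)⁻¹ (fun t => inv_mul_of (sElt_mul_inner n t))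
    (fun t => inv_mul_of (sElt_mul_outer n t)) (fun g => inv_mul_of (sElt_mul_incl n g))
  left_inv x := Subtype.ext (Subtype.ext (V.ρ.inv_self_apply (sElt n) x.1.1))
  right_inv x := Subtype.ext (Subtype.ext (V.ρ.self_inv_apply (sElt n) x.1.1))

end PolyRep

/-! ### The stable category -/

variable (F) in
/-- The objects of the stable category `𝓜`: sequences `(V_n, α_n)` of finite dimensional
polynomial representations `V_n` of `G_n` and isomorphisms `α_n : R_0 (V_{n+1}) ≅ V_n` of
representations of `G_n`, such that `V` is compact, i.e. only finitely many of its homogeneous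
components `V(k) = (V_n(k))_n` are nonzero. -/
structure StabObj where
  /-- the representation of `G_n` -/
  V : ∀ n : ℕ, PolyRep.{u, v} F n
  /-- the gluing isomorphisms -/
  α : ∀ n : ℕ, ((V (n + 1)).R 0).ρ.Equiv (V n).ρ
  compact : {k : ℤ | ∃ n, (V n).degreePart k ≠ ⊥}.Finite

namespace StabObj

/-- Morphisms of the stable category: the inverse limit of the spaces `Hom_{G_n}(V_n, W_n)`, i.e.
sequences of morphisms `f_n : V_n ⟶ W_n` with `f_n ∘ α_n = β_n ∘ R_0 (f_{n+1})`. -/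
@[ext]
structure Hom (V W : StabObj.{u, v} F) where
  /-- the component at level `n` -/
  app : ∀ n : ℕ, Representation.IntertwiningMap (V.V n).ρ (W.V n).ρ
  comm : ∀ n : ℕ, (app n).comp (V.α n).toIntertwiningMap =
    (W.α n).toIntertwiningMap.comp (PolyRep.mapR 0 (app (n + 1)))

instance : Category (StabObj.{u, v} F) where
  Hom V W := Hom V W
  id V := ⟨fun n => .id _, fun n => rfl⟩
  comp {U V W} f g := ⟨fun n => (g.app n).comp (f.app n), fun n => by
    have h1 := f.comm n
    have h2 := g.comm n
    apply Representation.IntertwiningMap.ext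
    ext x
    have h1' := congrArg (fun k => k x) h1
    have h2' := congrArg (fun k => k (PolyRep.mapR 0 (f.app (n + 1)) x)) h2
    exact (congrArg (g.app n) h1').trans h2'⟩

@[ext]
theorem hom_ext {V W : StabObj.{u, v} F} {f g : V ⟶ W} (h : ∀ n, f.app n = g.app n) : f = g :=
  Hom.ext (funext h)

/-- The morphisms as an additive group of sequences. -/
def homSubgroup (V W : StabObj.{u, v} F) :
    AddSubgroup (∀ n : ℕ, Representation.IntertwiningMap (V.V n).ρ (W.V n).ρ) where
  carrier := {f | ∀ n : ℕ, (f n).comp (V.α n).toIntertwiningMap =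
    (W.α n).toIntertwiningMap.comp (PolyRep.mapR 0 (f (n + 1)))}
  zero_mem' n := by
    apply Representation.IntertwiningMap.ext
    ext x
    exact (map_zero (W.α n)).symm
  add_mem' {f g} hf hg n := by
    apply Representation.IntertwiningMap.ext
    ext x
    have h1 := congrArg (fun k => k x) (hf n)
    have h2 := congrArg (fun k => k x) (hg n)
    exact (congrArg₂ (· + ·) h1 h2).trans (map_add (W.α n) _ _).symm
  neg_mem' {f} hf n := by
    apply Representation.IntertwiningMap.ext
    ext x
    have h1 := congrArg (fun k => k x) (hf n)
    exact (congrArg (fun y => -y) h1).trans (map_neg (W.α n) _).symm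

/-- A morphism is an element of the additive group of compatible sequences. -/
def homEquiv (V W : StabObj.{u, v} F) : (V ⟶ W) ≃ homSubgroup V W where
  toFun f := ⟨f.app, f.comm⟩
  invFun f := ⟨f.1, f.2⟩
  left_inv _ := rfl
  right_inv _ := rfl

instance : Preadditive (StabObj.{u, v} F) where
  homGroup V W := (homEquiv V W).addCommGroup
  add_comp U V W f g h := by
    apply hom_ext
    intro n
    apply Representation.IntertwiningMap.ext
    ext x
    exact map_add (h.app n) (f.app n x) (g.app n x)
  comp_add U V W f g h := by
    apply hom_ext
    intro n
    rfl

/-- The functor `E : 𝓜 ⥤ 𝓜`, with `E(V)_n = R_1 (V_{n+1})` and gluing maps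
`R_1 (α_{n+1}) ∘ s_{n+1}⁻¹`. -/
def E : StabObj.{u, v} F ⥤ StabObj.{u, v} F where
  obj V :=
    { V := fun n => (V.V (n + 1)).R 1
      α := fun n => ((V.V (n + 2)).swap 1 0).symm.trans (PolyRep.equivR 1 (V.α (n + 1)))
      compact := by
        refine (V.compact.preimage (f := fun k : ℤ => k + 1) (fun a _ b _ h => by
          simpa using h)).subset ?_
        rintro k ⟨n, hn⟩
        refine ⟨n + 1, ?_⟩
        obtain ⟨x, hx, hx0⟩ := (Submodule.ne_bot_iff _).1 hn
        refine (Submodule.ne_bot_iff _).2 ⟨x.1, fun z => ?_, fun h => hx0 (Subtype.ext h)⟩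
        have h1 : (V.V (n + 1)).ρ (incl n (scalarGL n z)) x.1 = ((z ^ k : Fˣ) : F) • x.1 :=
          congrArg Subtype.val (hx z)
        rw [PolyRep.scalarGL_succ, map_mul, Module.End.mul_apply, h1, map_smul, x.2 z, smul_smul,
          zpow_add, zpow_one, Units.val_mul] }
  map {V W} f := ⟨fun n => PolyRep.mapR 1 (f.app (n + 1)), fun n => by
    apply Representation.IntertwiningMap.ext
    ext x
    apply Subtype.ext
    have h := congrArg (fun k => k (((V.V (n + 2)).swap 1 0).symm x).1) (f.comm (n + 1))
    refine h.trans ?_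
    refine congrArg (W.α (n + 1)) (Subtype.ext ?_)
    exact Representation.IntertwiningMap.isIntertwining _ _ (f.app (n + 2)) (sElt n)⁻¹ x.1.1⟩
  map_id V := rfl
  map_comp f g := rfl

/-- The powers of `E`. -/
def Epow : ℕ → (StabObj.{u, v} F ⥤ StabObj.{u, v} F)
  | 0 => 𝟭 _
  | m + 1 => Epow m ⋙ E

/-- `yE X m i` is the endomorphism `E^{m-1-i} X E^{i}` of `E^m`, for `0 ≤ i < m`. It is `X E^{m-1}`
for `i = m - 1`, and `E` applied to `E^{m-2-i} X E^{i}` for `i < m - 1`. -/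
def yE (X : (E : StabObj.{u, v} F ⥤ StabObj.{u, v} F) ⟶ E) :
    ∀ m : ℕ, Fin m → End (Epow.{u, v} (F := F) m)
  | 0 => Fin.elim0
  | m + 1 => Fin.lastCases (motive := fun _ => End (Epow.{u, v} (F := F) (m + 1)))
      (Functor.whiskerLeft (Epow m) X) (fun i => Functor.whiskerRight (yE X m i) E)

/-- `tauE T m i` is the endomorphism `E^{m-2-i} T E^{i}` of `E^m`, for `0 ≤ i < m - 1`. It is
`T E^{m-2}` for `i = m - 2`, and `E` applied to `E^{m-3-i} T E^{i}` for `i < m - 2`. -/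
def tauE (T : (E ⋙ E : StabObj.{u, v} F ⥤ StabObj.{u, v} F) ⟶ E ⋙ E) :
    ∀ m : ℕ, Fin (m - 1) → End (Epow.{u, v} (F := F) m)
  | 0 => Fin.elim0
  | 1 => Fin.elim0
  | m + 2 => Fin.lastCases (motive := fun _ => End (Epow.{u, v} (F := F) (m + 2)))
      ((Functor.associator (Epow m) E E).hom ≫ Functor.whiskerLeft (Epow m) T ≫
        (Functor.associator (Epow m) E E).inv)
      (fun i => Functor.whiskerRight (tauE T (m + 1) i) E)

end StabObj

/-! ### The degenerate affine Hecke algebra -/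

/-- The simple transposition of `i` and `i + 1`. -/
def simpleRefl (m : ℕ) (i : Fin (m - 1)) : Equiv.Perm (Fin m) :=
  Equiv.swap ⟨i, by omega⟩ ⟨i + 1, by omega⟩

/-- The generators of the degenerate affine Hecke algebra: the variables `y_i` of the polynomial
ring and the elements of the symmetric group. -/
inductive HeckeGen (m : ℕ) : Type
  | y (i : Fin m) : HeckeGen m
  | w (σ : Equiv.Perm (Fin m)) : HeckeGen m

open HeckeGen FreeAlgebra in
/-- The relations of the degenerate affine Hecke algebra: those of the polynomial ring
`ℤ[y_1, …, y_m]`, those of the group ring `ℤ 𝔖_m`, and for the simple transpositions `τ_i` the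
relations `τ_i y_j = y_j τ_i` for `j ≠ i, i + 1` and `τ_i y_{i+1} - y_i τ_i = 1`. -/
inductive HeckeRel (m : ℕ) : FreeAlgebra ℤ (HeckeGen m) → FreeAlgebra ℤ (HeckeGen m) → Prop
  | y_comm (i j : Fin m) : HeckeRel m (ι ℤ (y i) * ι ℤ (y j)) (ι ℤ (y j) * ι ℤ (y i))
  | w_one : HeckeRel m (ι ℤ (w 1)) 1
  | w_mul (σ σ' : Equiv.Perm (Fin m)) :
      HeckeRel m (ι ℤ (w (σ * σ'))) (ι ℤ (w σ) * ι ℤ (w σ'))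
  | comm (i : Fin (m - 1)) (j : Fin m) (h : (j : ℕ) ≠ i) (h' : (j : ℕ) ≠ i + 1) :
      HeckeRel m (ι ℤ (w (simpleRefl m i)) * ι ℤ (y j)) (ι ℤ (y j) * ι ℤ (w (simpleRefl m i)))
  | exchange (i : Fin (m - 1)) :
      HeckeRel m (ι ℤ (w (simpleRefl m i)) * ι ℤ (y ⟨i + 1, by omega⟩) -
        ι ℤ (y ⟨i, by omega⟩) * ι ℤ (w (simpleRefl m i))) 1

/-- The degenerate affine Hecke algebra of `GL_m`, over `ℤ`. -/
abbrev Hecke (m : ℕ) : Type := RingQuot (HeckeRel m)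

namespace Hecke

/-- The generator `y_{i+1}`, for `0 ≤ i < m`. -/
def y {m : ℕ} (i : Fin m) : Hecke m :=
  RingQuot.mkRingHom (HeckeRel m) (FreeAlgebra.ι ℤ (HeckeGen.y i))

/-- The simple transposition `τ_{i+1}`, for `0 ≤ i < m - 1`. -/
def tau {m : ℕ} (i : Fin (m - 1)) : Hecke m :=
  RingQuot.mkRingHom (HeckeRel m) (FreeAlgebra.ι ℤ (HeckeGen.w (simpleRefl m i)))

end Hecke

end PolyFock

end

/-!
Why the operators `X_n` and `s_{n+1}` satisfy the relations of the degenerate affine Hecke algebra.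

The Lie algebra acts by derivatives of matrix coefficients, so conjugation, morphisms and
restriction to `G_n` are transported by the chain rule (`ρ_lieAct`, `map_lieAct`, `inclR_lieAct`).
The sum in `X_n` is a contraction of dual bases for `G_n`, hence `X_n` commutes with `G_n` and with
the last coordinate subgroup `G_1`. Conjugation by `s_{n+1}` turns `X_n` into `X_{n+1}` without the
term `x_{n+2,n+1} x_{n+1,n+2}` and with another constant (`ρ_sElt_opX`). Everything thus depends on
this one term, on vectors of weight `(0, 1)` (compatibility of `X` with the gluing maps) and of
weight `(1, 1)` (the relation between `X` and `T`) for the last two coordinates.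

To compute it, let the root subgroup `1 + t x_{n+1,n+2}` act on a vector of weight `w` for the last
coordinate. The result is polynomial in `t` with linear coefficient given by the Lie algebra, and
the coefficient of `t ^ k` has weight `w - k`. A polynomial representation has no negative weights
(`eq_zero_of_neg_weight`), so the degree is at most `w` (`exists_expansion_of_weight`). The rotation
`s_{n+1}` is the product of three root subgroup elements; comparing the parts of equal weight shows
that the term is the identity on weight `(0, 1)` (`lieAct_lieAct_of_weight_zero_one`), and
`1 - s_{n+1}` on weight `(1, 1)` (`lieAct_lieAct_of_weight_one_one`). The latter is the relation
`T ∘ XE - EX ∘ T = 1`.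

The compatibility of `T` with the gluing maps is the braid relation `sElt_braid`, and `T² = 1` holds
because `s_{n+1}²` is diagonal with two entries `-1`.

For the action of the Hecke algebra on `E^m`, the relations which involve a `y_i` follow from the
naturality of `X` and `T` and from the relation above, by induction on `m`. Those of the symmetric
group are not checked on generators: `E^m(V)_n` is a subspace of `V_{n+m}` of weight `(1, …, 1)` for
the last `m` coordinates, and `τ_i` acts on it as a signed permutation matrix. So an endomorphism
which acts by the sign of `σ` times its permutation matrix exists for every `σ`, as adjacent
transpositions generate (`exists_represents`), and it is unique (`Represents.unique`); hence these
endomorphisms multiply as the permutations do.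
-/

noncomputable section

namespace PolyFock

variable {F : Type u} [Field F]

/-! ### Polynomials on matrices and their derivatives at the identity -/

namespace PolyRep

section Derivative
variable {n N : ℕ}

theorem eval_aeval {σ τ : Type*} (x : τ → F) (S : σ → MvPolynomial τ F) (P : MvPolynomial σ F) :
    MvPolynomial.eval x (MvPolynomial.aeval S P) =
      MvPolynomial.eval (fun i => MvPolynomial.eval x (S i)) P := by
  induction P using MvPolynomial.induction_on with
  | C a => simp
  | add p q hp hq => simp only [map_add, hp, hq]
  | mul_X p i hp => simp only [map_mul, hp, MvPolynomial.aeval_X, MvPolynomial.eval_X]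

/-- Evaluation of a polynomial on matrices at the identity matrix. -/
def evalAtOne (P : MvPolynomial (Fin n × Fin n) F) : F :=
  MvPolynomial.eval (fun kl => (1 : Matrix (Fin n) (Fin n) F) kl.1 kl.2) P

@[simp]
theorem derivAtOne_C (A : Matrix (Fin n) (Fin n) F) (c : F) :
    derivAtOne A (MvPolynomial.C c) = 0 := by
  simp [derivAtOne]

@[simp]
theorem derivAtOne_X (A : Matrix (Fin n) (Fin n) F) (kl : Fin n × Fin n) :
    derivAtOne A (MvPolynomial.X kl) = A kl.1 kl.2 := by
  rw [derivAtOne, Finset.sum_eq_single kl]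
  · simp
  · intro ij _ h
    rw [MvPolynomial.pderiv_X_of_ne h.symm, map_zero, mul_zero]
  · simp

theorem derivAtOne_add (A : Matrix (Fin n) (Fin n) F) (P Q : MvPolynomial (Fin n × Fin n) F) :
    derivAtOne A (P + Q) = derivAtOne A P + derivAtOne A Q := by
  simp only [derivAtOne, map_add, mul_add, Finset.sum_add_distrib]

theorem derivAtOne_mul (A : Matrix (Fin n) (Fin n) F) (P Q : MvPolynomial (Fin n × Fin n) F) :
    derivAtOne A (P * Q) = derivAtOne A P * evalAtOne Q + evalAtOne P * derivAtOne A Q := by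
  simp only [derivAtOne, evalAtOne, MvPolynomial.pderiv_mul, map_add, map_mul, Finset.sum_mul,
    Finset.mul_sum, ← Finset.sum_add_distrib]
  exact Finset.sum_congr rfl fun _ _ => by ring

theorem derivAtOne_sum {ι : Type*} (A : Matrix (Fin n) (Fin n) F) (s : Finset ι)
    (P : ι → MvPolynomial (Fin n × Fin n) F) :
    derivAtOne A (∑ i ∈ s, P i) = ∑ i ∈ s, derivAtOne A (P i) := by
  classical
  induction s using Finset.induction_on with
  | empty => simpa using derivAtOne_C A 0
  | insert a s ha ih => rw [Finset.sum_insert ha, Finset.sum_insert ha, derivAtOne_add, ih]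

theorem derivAtOne_C_mul (A : Matrix (Fin n) (Fin n) F) (c : F)
    (P : MvPolynomial (Fin n × Fin n) F) :
    derivAtOne A (MvPolynomial.C c * P) = c * derivAtOne A P := by
  rw [derivAtOne_mul, derivAtOne_C]
  simp [evalAtOne]

/-- The chain rule, for a substitution which sends the identity matrix to the identity matrix and
the tangent direction `A` to `B`. -/
theorem derivAtOne_aeval (A : Matrix (Fin n) (Fin n) F) (B : Matrix (Fin N) (Fin N) F)
    (S : Fin N × Fin N → MvPolynomial (Fin n × Fin n) F)
    (hS : ∀ ij, evalAtOne (S ij) = (1 : Matrix (Fin N) (Fin N) F) ij.1 ij.2)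
    (hA : ∀ ij, derivAtOne A (S ij) = B ij.1 ij.2) (P : MvPolynomial (Fin N × Fin N) F) :
    derivAtOne A (MvPolynomial.aeval S P) = derivAtOne B P := by
  have hev : ∀ P : MvPolynomial (Fin N × Fin N) F,
      evalAtOne (MvPolynomial.aeval S P) = evalAtOne P := by
    intro P
    induction P using MvPolynomial.induction_on with
    | C a => simp [evalAtOne]
    | add p q hp hq => simp only [evalAtOne, map_add] at *; rw [hp, hq]
    | mul_X p i hp =>
      have := hS i
      simp only [evalAtOne, map_mul, MvPolynomial.aeval_X, MvPolynomial.eval_X] at *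
      rw [hp, this]
  induction P using MvPolynomial.induction_on with
  | C a => rw [MvPolynomial.algHom_C, MvPolynomial.algebraMap_eq, derivAtOne_C, derivAtOne_C]
  | add p q hp hq => rw [map_add, derivAtOne_add, derivAtOne_add, hp, hq]
  | mul_X p i hp =>
    rw [map_mul, derivAtOne_mul, derivAtOne_mul, hp, MvPolynomial.aeval_X, hA, hev, derivAtOne_X]
    congr 2
    rw [hS]
    simp [evalAtOne]

/-- The restriction of a polynomial on matrices to the line through the identity matrix in the
direction `A`. -/
def alongLine (A : Matrix (Fin n) (Fin n) F) (P : MvPolynomial (Fin n × Fin n) F) :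
    Polynomial F :=
  MvPolynomial.aeval (fun ij => Polynomial.C ((1 : Matrix (Fin n) (Fin n) F) ij.1 ij.2) +
    Polynomial.C (A ij.1 ij.2) * Polynomial.X) P

theorem alongLine_eval (A : Matrix (Fin n) (Fin n) F) (P : MvPolynomial (Fin n × Fin n) F)
    (t : F) : (alongLine A P).eval t =
      MvPolynomial.eval (fun ij => (1 + t • A : Matrix (Fin n) (Fin n) F) ij.1 ij.2) P := by
  induction P using MvPolynomial.induction_on with
  | C a => simp [alongLine]
  | add p q hp hq => simp only [alongLine, map_add, Polynomial.eval_add] at *; rw [hp, hq]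
  | mul_X p i hp =>
    simp only [alongLine, map_mul, Polynomial.eval_mul, MvPolynomial.aeval_X,
      MvPolynomial.eval_X] at *
    rw [hp]
    simp only [Polynomial.eval_add, Polynomial.eval_mul, Polynomial.eval_C, Polynomial.eval_X,
      Matrix.add_apply, Matrix.smul_apply, smul_eq_mul, mul_comm t]

/-- The derivative at the identity is the linear coefficient along a line. -/
theorem alongLine_coeff_one (A : Matrix (Fin n) (Fin n) F)
    (P : MvPolynomial (Fin n × Fin n) F) : (alongLine A P).coeff 1 = derivAtOne A P := by
  have h0 : ∀ P, (alongLine A P).coeff 0 = evalAtOne P := fun P => by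
    rw [Polynomial.coeff_zero_eq_eval_zero, alongLine_eval]
    simp [evalAtOne]
  induction P using MvPolynomial.induction_on with
  | C a => simp [alongLine]
  | add p q hp hq =>
    rw [derivAtOne_add, ← hp, ← hq, alongLine, map_add, Polynomial.coeff_add]; rfl
  | mul_X p i hp =>
    rw [derivAtOne_mul, ← hp, derivAtOne_X, ← h0, ← h0, alongLine, map_mul,
      Polynomial.mul_coeff_one, MvPolynomial.aeval_X]
    simp [alongLine]
    ring

end Derivative

/-! ### The Lie algebra action: equivariance, naturality, restriction -/

section Lie
variable {n : ℕ}

theorem lieAct_add (V : PolyRep.{u, v} F n) (A B : Matrix (Fin n) (Fin n) F) :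
    V.lieAct (A + B) = V.lieAct A + V.lieAct B := by
  rw [lieAct, lieAct, lieAct, ← map_add]
  congr 1
  ext k j
  simp [derivAtOne, add_mul, Finset.sum_add_distrib]

theorem lieAct_smul (V : PolyRep.{u, v} F n) (c : F) (A : Matrix (Fin n) (Fin n) F) :
    V.lieAct (c • A) = c • V.lieAct A := by
  rw [lieAct, lieAct, ← map_smul]
  congr 1
  ext k j
  simp [derivAtOne, Finset.mul_sum, mul_assoc]

theorem lieAct_sum {ι : Type*} (V : PolyRep.{u, v} F n) (s : Finset ι)
    (A : ι → Matrix (Fin n) (Fin n) F) :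
    V.lieAct (∑ i ∈ s, A i) = ∑ i ∈ s, V.lieAct (A i) := by
  classical
  induction s using Finset.induction_on with
  | empty => simpa using V.lieAct_smul 0 0
  | insert a s ha ih => rw [Finset.sum_insert ha, Finset.sum_insert ha, lieAct_add, ih]

variable (F) in
theorem ext_dual {V : Type*} [AddCommGroup V] [Module F V] {x y : V}
    (h : ∀ φ : Module.Dual F V, φ x = φ y) : x = y := by
  rw [← sub_eq_zero, ← Module.forall_dual_apply_eq_zero_iff F]
  intro φ
  rw [map_sub, h, sub_self]

theorem incl_cc (g : GL (Fin n) F) (i j : Fin n) :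
    (incl n g).val i.castSucc j.castSucc = g.val i j :=
  blockGL_cc (n := n) (k := 1) _ i j

theorem incl_cl (g : GL (Fin n) F) (i : Fin n) :
    (incl n g).val i.castSucc (Fin.last n) = 0 :=
  blockGL_cn (n := n) (k := 1) _ i 0

theorem incl_lc (g : GL (Fin n) F) (i : Fin n) :
    (incl n g).val (Fin.last n) i.castSucc = 0 :=
  blockGL_nc (n := n) (k := 1) _ 0 i

theorem incl_ll (g : GL (Fin n) F) :
    (incl n g).val (Fin.last n) (Fin.last n) = 1 :=
  blockGL_nn (n := n) (k := 1) (g, 1) 0 0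

variable [Infinite F]

/-- Morphisms of representations of the group are morphisms for the Lie algebra. -/
theorem map_lieAct {V W : PolyRep.{u, v} F n} (f : Representation.IntertwiningMap V.ρ W.ρ)
    (A : Matrix (Fin n) (Fin n) F) (x : V.carrier) :
    f (V.lieAct A x) = W.lieAct A (f x) := by
  refine ext_dual F fun φ => ?_
  obtain ⟨P, hP⟩ := V.polynomial (φ ∘ₗ f.toLinearMap) x
  have h1 := V.lieAct_spec A _ x P hP
  rw [W.lieAct_spec A φ (f x) P fun g => ?_]
  · exact h1
  · rw [← hP g, ← Representation.IntertwiningMap.isIntertwining]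
    rfl

/-- The adjoint action: if `g A g⁻¹ = B`, then `g` carries the action of `A` to that of `B`. -/
theorem ρ_lieAct (V : PolyRep.{u, v} F n) (g : GL (Fin n) F) {A B : Matrix (Fin n) (Fin n) F}
    (h : g.val * A = B * g.val) (x : V.carrier) :
    V.ρ g (V.lieAct A x) = V.lieAct B (V.ρ g x) := by
  -- the matrix coefficients of `h ↦ g h g⁻¹` arise by the substitution `S` of linear forms
  obtain ⟨y, rfl⟩ : ∃ y, x = V.ρ g⁻¹ y := ⟨V.ρ g x, by simp⟩
  rw [Representation.self_inv_apply]
  refine ext_dual F fun φ => ?_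
  obtain ⟨P, hP⟩ := V.polynomial φ y
  rw [V.lieAct_spec B φ y P hP]
  let S : Fin n × Fin n → MvPolynomial (Fin n × Fin n) F := fun ij =>
    ∑ k, ∑ l, MvPolynomial.C (g.val ij.1 k * (g⁻¹).val l ij.2) * MvPolynomial.X (k, l)
  have hS : ∀ (M : Matrix (Fin n) (Fin n) F) (ij : Fin n × Fin n),
      ∑ k, ∑ l, g.val ij.1 k * (g⁻¹).val l ij.2 * M k l = (g.val * M * (g⁻¹).val) ij.1 ij.2 := by
    intro M ij
    simp only [Matrix.mul_apply, Finset.sum_mul]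
    rw [Finset.sum_comm]
    exact Finset.sum_congr rfl fun _ _ => Finset.sum_congr rfl fun _ _ => by ring
  have hev : ∀ M : Matrix (Fin n) (Fin n) F, ∀ ij,
      MvPolynomial.eval (fun kl => M kl.1 kl.2) (S ij) = (g.val * M * (g⁻¹).val) ij.1 ij.2 := by
    intro M ij
    rw [← hS]
    simp [S]
  rw [← derivAtOne_aeval A B S]
  · refine V.lieAct_spec A (φ ∘ₗ V.ρ g) _ _ fun k => ?_
    have h1 : (φ ∘ₗ V.ρ g) (V.ρ k (V.ρ g⁻¹ y)) = φ (V.ρ (g * k * g⁻¹) y) := by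
      simp [map_mul]
    rw [h1, hP, eval_aeval]
    simp only [hev k.val]
    rfl
  · intro ij
    rw [evalAtOne, hev, mul_one, Units.mul_inv]
  · intro ij
    simp only [S, derivAtOne_sum, derivAtOne_C_mul, derivAtOne_X]
    rw [hS, h, mul_assoc, Units.mul_inv, mul_one]

/-- The action of a matrix unit of `𝔤𝔩_n` on `R_i V` is that of the same matrix unit
of `𝔤𝔩_{n+1}` on `V`. -/
theorem inclR_lieAct (V : PolyRep.{u, v} F (n + 1)) (i : ℤ) (a b : Fin n)
    (x : (V.R i).carrier) :
    V.inclR i ((V.R i).lieAct (Matrix.single a b 1) x) =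
      V.lieAct (Matrix.single a.castSucc b.castSucc 1) (V.inclR i x) := by
  refine ext_dual F fun φ => ?_
  obtain ⟨P, hP⟩ := V.polynomial φ (V.inclR i x)
  rw [V.lieAct_spec _ φ _ P hP]
  -- the substitution describing the embedding of `n × n` matrices by `M ↦ diag(M, 1)`
  let S : Fin (n + 1) × Fin (n + 1) → MvPolynomial (Fin n × Fin n) F := fun ij =>
    Fin.lastCases (motive := fun _ => MvPolynomial (Fin n × Fin n) F)
      (Fin.lastCases (motive := fun _ => MvPolynomial (Fin n × Fin n) F) 1 (fun _ => 0) ij.2)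
      (fun k => Fin.lastCases (motive := fun _ => MvPolynomial (Fin n × Fin n) F) 0
        (fun l => MvPolynomial.X (k, l)) ij.2) ij.1
  have hev : ∀ (g : GL (Fin n) F) ij,
      MvPolynomial.eval (fun kl => g.val kl.1 kl.2) (S ij) = (incl n g).val ij.1 ij.2 := by
    rintro g ⟨k, l⟩
    induction k using Fin.lastCases <;> induction l using Fin.lastCases <;>
      simp [S, incl_cc, incl_cl, incl_lc, incl_ll]
  rw [← derivAtOne_aeval (Matrix.single a b 1) _ S]
  · refine (V.R i).lieAct_spec _ (φ ∘ₗ V.inclR i) _ _ fun k => ?_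
    have h1 : (φ ∘ₗ V.inclR i) ((V.R i).ρ k x) = φ (V.ρ (incl n k) (V.inclR i x)) := rfl
    rw [h1, hP, eval_aeval]
    simp only [hev]
  · intro ij
    have := hev 1 ij
    rw [map_one] at this
    exact this
  · have hc : ∀ c d : Fin n, (c.castSucc : Fin (n + 1)) ≠ Fin.last n := fun c _ =>
      (Fin.castSucc_lt_last c).ne
    have h0 := derivAtOne_C (Matrix.single a b (1 : F)) 0
    have h1 := derivAtOne_C (Matrix.single a b (1 : F)) 1
    rw [map_zero] at h0
    rw [map_one] at h1
    rintro ⟨k, l⟩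
    induction k using Fin.lastCases <;> induction l using Fin.lastCases <;>
      simp [S, Matrix.single_apply, h0, h1, Fin.castSucc_inj, (Fin.castSucc_lt_last _).ne]

end Lie

/-! ### One-parameter subgroups and weights -/

section OneParameter

/-- Vector valued polynomials in one variable which vanish on `Fˣ` have zero coefficients. -/
theorem coeff_eq_zero_of_sum_eq_zero [Infinite F] {V : Type*} [AddCommGroup V] [Module F V] {K : ℕ}
    (a : ℕ → V) (h : ∀ t : Fˣ, ∑ k ∈ Finset.range K, (t : F) ^ k • a k = 0) {k : ℕ} (hk : k < K) :
    a k = 0 := by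
  refine ext_dual F fun φ => ?_
  set p : Polynomial F := ∑ k ∈ Finset.range K, Polynomial.C (φ (a k)) * Polynomial.X ^ k with hp
  have h0 : Polynomial.X * p = 0 := by
    refine Polynomial.funext fun t => ?_
    by_cases ht : t = 0
    · simp [ht]
    · have := congrArg φ (h (Units.mk0 t ht))
      simp only [map_sum, map_smul, Units.val_mk0, map_zero, smul_eq_mul] at this
      simp only [hp, Polynomial.eval_mul, Polynomial.eval_X, Polynomial.eval_finsetSum,
        Polynomial.eval_C, Polynomial.eval_pow, Polynomial.eval_zero, mul_comm (φ _), this,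
        mul_zero]
  have h1 : p = 0 := (mul_eq_zero.1 h0).resolve_left Polynomial.X_ne_zero
  have h2 : p.coeff k = φ (a k) := by
    simp [hp, Polynomial.coeff_C_mul, Polynomial.coeff_X_pow, hk]
  rw [← h2, h1, Polynomial.coeff_zero, map_zero]

variable {n : ℕ} [Infinite F]

/-- The action of a family `1 + t A` in `G_n` on a vector is polynomial in `t`, with linear
coefficient given by the Lie algebra action of `A`. If `d` conjugates the family to its rescaling
by `c`, then `d` scales the `k`-th coefficient by `c ^ k` times the scalar by which it acts on the
given vector. -/
theorem exists_expansion (V : PolyRep.{u, v} F n) (A : Matrix (Fin n) (Fin n) F)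
    (g : F → GL (Fin n) F) (hg : ∀ t, (g t).val = 1 + t • A) (x : V.carrier) :
    ∃ (K : ℕ) (y : ℕ → V.carrier), (∀ k, K ≤ k → y k = 0) ∧ y 0 = x ∧ y 1 = V.lieAct A x ∧
      (∀ t, V.ρ (g t) x = ∑ k ∈ Finset.range K, t ^ k • y k) ∧
      ∀ (d : GL (Fin n) F) (c e : F), (∀ t, d * g t = g (c * t) * d) → V.ρ d x = e • x →
        ∀ k, V.ρ d (y k) = (e * c ^ k) • y k := by
  set b := Module.finBasis F V.carrier with hb
  choose P hP using fun j => V.polynomial (b.coord j) x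
  set K := (Finset.univ.sup fun j => (alongLine A (P j)).natDegree) + 2 with hK
  have hdeg : ∀ j, (alongLine A (P j)).natDegree < K := fun j => by
    have := Finset.le_sup (f := fun j => (alongLine A (P j)).natDegree) (Finset.mem_univ j)
    omega
  set y : ℕ → V.carrier := fun k => ∑ j, (alongLine A (P j)).coeff k • b j with hy
  have hyK : ∀ k, K ≤ k → y k = 0 := fun k hk => Finset.sum_eq_zero fun j _ => by
    rw [Polynomial.coeff_eq_zero_of_natDegree_lt ((hdeg j).trans_le hk), zero_smul]
  have hexp : ∀ t, V.ρ (g t) x = ∑ k ∈ Finset.range K, t ^ k • y k := by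
    intro t
    simp only [hy, Finset.smul_sum]
    rw [Finset.sum_comm, ← b.sum_repr (V.ρ (g t) x)]
    refine Finset.sum_congr rfl fun j _ => ?_
    have h1 : b.repr (V.ρ (g t) x) j = (alongLine A (P j)).eval t := by
      rw [alongLine_eval, ← hg t, ← hP j (g t)]
      rfl
    rw [h1, Polynomial.eval_eq_sum_range' (hdeg j), Finset.sum_smul]
    exact Finset.sum_congr rfl fun k _ => by rw [smul_smul, mul_comm]
  refine ⟨K, y, hyK, ?_, ?_, hexp, ?_⟩
  · have h1 : g 0 = 1 := Units.ext (by rw [hg, zero_smul, add_zero, Units.val_one])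
    have h2 := hexp 0
    rw [h1, map_one, Module.End.one_apply, Finset.sum_eq_single 0] at h2
    · rw [h2, pow_zero, one_smul]
    · intro k _ hk
      rw [zero_pow hk, zero_smul]
    · intro h
      exact absurd (Finset.mem_range.2 (by omega)) h
  · conv_rhs => rw [← b.sum_repr (V.lieAct A x)]
    refine Finset.sum_congr rfl fun j _ => ?_
    rw [alongLine_coeff_one, ← V.lieAct_spec A (b.coord j) x (P j) (hP j)]
    rfl
  · intro d c e hd he k
    rcases le_or_gt K k with hk | hk
    · rw [hyK k hk, map_zero, smul_zero]
    rw [← sub_eq_zero]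
    refine coeff_eq_zero_of_sum_eq_zero (F := F) (K := K)
      (fun k => V.ρ d (y k) - (e * c ^ k) • y k) (fun t => ?_) hk
    have h1 : V.ρ d (V.ρ (g t) x) = V.ρ (g (c * t)) (V.ρ d x) := by
      rw [← Module.End.mul_apply, ← Module.End.mul_apply, ← map_mul, ← map_mul, hd]
    rw [he, map_smul, hexp, hexp, map_sum, ← sub_eq_zero, Finset.smul_sum,
      ← Finset.sum_sub_distrib] at h1
    rw [← h1]
    refine Finset.sum_congr rfl fun k _ => ?_
    rw [map_smul, smul_sub, smul_smul, smul_smul, mul_pow]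
    congr 2
    ring

/-- The weights of a polynomial representation for a coordinate subgroup `G_1` are not negative. -/
theorem eq_zero_of_neg_weight (V : PolyRep.{u, v} F n) (b : Fin n) (d : Fˣ → GL (Fin n) F)
    (hd : ∀ t, (d t).val = 1 + ((t : F) - 1) • Matrix.single b b 1) (m : ℕ) (x : V.carrier)
    (hx : ∀ t : Fˣ, (t : F) ^ (m + 1) • V.ρ (d t) x = x) : x = 0 := by
  refine ext_dual F fun φ => ?_
  obtain ⟨P, hP⟩ := V.polynomial φ x
  -- `q t` is the matrix coefficient at `d t`, so `t ^ (m + 1) * q t` is the constant `φ x`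
  set q := (alongLine (Matrix.single b b 1) P).comp (Polynomial.X - 1) with hq
  have h1 : Polynomial.X * (Polynomial.X ^ (m + 1) * q - Polynomial.C (φ x)) = 0 := by
    refine Polynomial.funext fun t => ?_
    by_cases ht : t = 0
    · simp [ht]
    · have h2 := congrArg φ (hx (Units.mk0 t ht))
      rw [map_smul, hP, hd, ← alongLine_eval, Units.val_mk0, smul_eq_mul] at h2
      have h3 : q.eval t = (alongLine (Matrix.single b b 1) P).eval (t - 1) := by
        simp [hq, Polynomial.eval_comp]
      rw [Polynomial.eval_mul, Polynomial.eval_sub, Polynomial.eval_mul, h3]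
      simp only [Polynomial.eval_pow, Polynomial.eval_X, Polynomial.eval_C, h2, sub_self, mul_zero,
        Polynomial.eval_zero]
  have h2 := congrArg (Polynomial.eval 0) ((mul_eq_zero.1 h1).resolve_left Polynomial.X_ne_zero)
  simpa using h2.symm

/-- The expansion of the action of a root subgroup on a vector of weight `w` for the coordinate
subgroup `d` which the root subgroup lowers: it is of degree at most `w`, since there are no
vectors of negative weight. -/
theorem exists_expansion_of_weight (V : PolyRep.{u, v} F n) (A : Matrix (Fin n) (Fin n) F)
    (g : F → GL (Fin n) F) (hg : ∀ t, (g t).val = 1 + t • A) (b : Fin n) (d : Fˣ → GL (Fin n) F)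
    (hd : ∀ t, (d t).val = 1 + ((t : F) - 1) • Matrix.single b b 1)
    (hdg : ∀ s t, d s * g t = g ((s⁻¹ : Fˣ) * t) * d s) (w : ℕ) (x : V.carrier)
    (hx : ∀ s, V.ρ (d s) x = (s : F) ^ w • x) :
    ∃ y : ℕ → V.carrier, (∀ k, w < k → y k = 0) ∧ y 0 = x ∧ y 1 = V.lieAct A x ∧
      (∀ t, V.ρ (g t) x = ∑ k ∈ Finset.range (w + 1), t ^ k • y k) ∧
      ∀ (d : GL (Fin n) F) (c e : F), (∀ t, d * g t = g (c * t) * d) → V.ρ d x = e • x →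
        ∀ k, V.ρ d (y k) = (e * c ^ k) • y k := by
  obtain ⟨K, y, hyK, hy0, hy1, hexp, hconj⟩ := V.exists_expansion A g hg x
  have hyw : ∀ k, w < k → y k = 0 := by
    intro k hk
    obtain ⟨m, rfl⟩ := Nat.exists_eq_add_of_lt hk
    refine V.eq_zero_of_neg_weight b d hd m _ fun s => ?_
    rw [hconj (d s) _ _ (hdg s) (hx s), smul_smul]
    have : (s : F) ^ (m + 1) * ((s : F) ^ w * ((s⁻¹ : Fˣ) : F) ^ (w + m + 1)) = 1 := by
      rw [← mul_assoc, ← pow_add, show m + 1 + w = w + m + 1 by omega, ← mul_pow, Units.mul_inv,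
        one_pow]
    rw [this, one_smul]
  refine ⟨y, hyw, hy0, hy1, fun t => ?_, hconj⟩
  rw [hexp t, ← Finset.eventually_constant_sum (n := max K (w + 1)) _ (le_max_left _ _),
    ← Finset.eventually_constant_sum (n := max K (w + 1)) _ (le_max_right _ _)]
  · exact fun k hk => by rw [hyw k hk, smul_zero]
  · exact fun k hk => by rw [hyK k hk, smul_zero]

end OneParameter

/-! ### The root subgroups for the last two indices -/

section RankTwo

theorem blockGL_val_eq_add {n k : ℕ} (g : GL (Fin k) F) (t : F) (a b : Fin k)
    (hg : g.val = 1 + t • Matrix.single a b 1) :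
    (blockGL n k (1, g)).val =
      1 + t • Matrix.single (Fin.natAdd n a) (Fin.natAdd n b) 1 := by
  have hne : ∀ (i : Fin n) (j : Fin k), Fin.castAdd k i ≠ Fin.natAdd n j := fun i j h => by
    have := congrArg Fin.val h
    simp at this
    omega
  ext i j
  induction i using Fin.addCases with
  | left i =>
    induction j using Fin.addCases with
    | left j => simp [blockGL_cc, Matrix.one_apply, (hne _ _).symm]
    | right j => simp [blockGL_cn, hne, (hne _ _).symm]
  | right i =>
    induction j using Fin.addCases with
    | left j => simp [blockGL_nc, (hne _ _).symm]
    | right j => simp [blockGL_nn, hg, Matrix.single_apply, Matrix.one_apply, Fin.ext_iff]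

variable (F) in
/-- The upper triangular unipotent matrix `[[1, t], [0, 1]]`. -/
def upper (t : F) : GL (Fin 2) F where
  val := !![1, t; 0, 1]
  inv := !![1, -t; 0, 1]
  val_inv := by simp [Matrix.one_fin_two]
  inv_val := by simp [Matrix.one_fin_two]

variable (F) in
/-- The lower triangular unipotent matrix `[[1, 0], [t, 1]]`. -/
def lower (t : F) : GL (Fin 2) F where
  val := !![1, 0; t, 1]
  inv := !![1, 0; -t, 1]
  val_inv := by simp [Matrix.one_fin_two]
  inv_val := by simp [Matrix.one_fin_two]

theorem upper_val (t : F) : (upper F t).val = 1 + t • Matrix.single 0 1 1 := by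
  ext i j; fin_cases i <;> fin_cases j <;> simp [upper]

theorem lower_val (t : F) : (lower F t).val = 1 + t • Matrix.single 1 0 1 := by
  ext i j; fin_cases i <;> fin_cases j <;> simp [lower]

/-- The rotation is a product of three unipotent matrices; here one of them is moved to the
other side. -/
theorem upper_mul_rot : upper F 1 * rot = lower F 1 * upper F (-1) := by
  apply Units.ext
  simp [upper, lower, rot]

theorem blockGL_left_val (t : Fˣ) :
    (blockGL 1 1 (scalarGL 1 t, 1)).val = !![(t : F), 0; 0, 1] := by
  rw [blockGL_one_one]; simp [scalarGL]

theorem blockGL_right_val (t : Fˣ) :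
    (blockGL 1 1 (1, scalarGL 1 t)).val = !![1, 0; 0, (t : F)] := by
  rw [blockGL_one_one]; simp [scalarGL]

variable (n : ℕ)

/-- The root subgroup of `G_{n+2}` for the pair of indices `(n + 1, n + 2)`. -/
def upperGL (t : F) : GL (Fin (n + 2)) F := blockGL n 2 (1, upper F t)

/-- The root subgroup of `G_{n+2}` for the pair of indices `(n + 2, n + 1)`. -/
def lowerGL (t : F) : GL (Fin (n + 2)) F := blockGL n 2 (1, lower F t)

theorem upperGL_val (t : F) : (upperGL n t).val =
    1 + t • Matrix.single (Fin.last n).castSucc (Fin.last (n + 1)) 1 :=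
  blockGL_val_eq_add _ _ _ _ (upper_val t)

theorem lowerGL_val (t : F) : (lowerGL n t).val =
    1 + t • Matrix.single (Fin.last (n + 1)) (Fin.last n).castSucc 1 :=
  blockGL_val_eq_add _ _ _ _ (lower_val t)

theorem lastTorus_val (t : Fˣ) : (lastTorus n t).val =
    1 + ((t : F) - 1) • Matrix.single (Fin.last n) (Fin.last n) 1 := by
  refine blockGL_val_eq_add (scalarGL 1 t) _ 0 0 ?_
  ext i j; fin_cases i; fin_cases j; simp [scalarGL]

theorem incl_lastTorus_val (t : Fˣ) : (incl (n + 1) (lastTorus n t)).val =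
    1 + ((t : F) - 1) • Matrix.single (Fin.last n).castSucc (Fin.last n).castSucc 1 := by
  rw [incl_lastTorus_eq]
  refine blockGL_val_eq_add _ _ 0 0 ?_
  rw [blockGL_left_val]
  ext i j; fin_cases i <;> fin_cases j <;> simp

variable {n}

theorem blockGL_mul_eq {k : ℕ} {g h g' h' : GL (Fin k) F} (H : g.val * h.val = g'.val * h'.val) :
    blockGL n k (1, g) * blockGL n k (1, h) = blockGL n k (1, g') * blockGL n k (1, h') := by
  rw [← map_mul, ← map_mul, Prod.mk_mul_mk, Prod.mk_mul_mk, show g * h = g' * h' from Units.ext H]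

theorem upperGL_mul_sElt :
    upperGL n (1 : F) * sElt n = lowerGL n 1 * upperGL n (-1) :=
  blockGL_mul_eq (congrArg Units.val upper_mul_rot)

theorem lastTorus_mul_upperGL (s : Fˣ) (t : F) :
    lastTorus (n + 1) s * upperGL n t = upperGL n ((s⁻¹ : Fˣ) * t) * lastTorus (n + 1) s := by
  rw [lastTorus_eq]
  refine blockGL_mul_eq ?_
  rw [blockGL_right_val]
  simp [upper, mul_comm _ t]

theorem incl_lastTorus_mul_lowerGL (s : Fˣ) (t : F) :
    incl (n + 1) (lastTorus n s) * lowerGL n t =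
      lowerGL n ((s⁻¹ : Fˣ) * t) * incl (n + 1) (lastTorus n s) := by
  rw [incl_lastTorus_eq]
  refine blockGL_mul_eq ?_
  rw [blockGL_left_val]
  simp [lower, mul_comm _ t]

theorem incl_lastTorus_mul_single (s : Fˣ) :
    (incl (n + 1) (lastTorus n s)).val *
        Matrix.single (Fin.last n).castSucc (Fin.last (n + 1)) 1 =
      ((s : F) • Matrix.single (Fin.last n).castSucc (Fin.last (n + 1)) 1) *
        (incl (n + 1) (lastTorus n s)).val := by
  have hne : (Fin.last (n + 1)) ≠ (Fin.last n).castSucc := (Fin.castSucc_lt_last _).ne'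
  rw [incl_lastTorus_val, add_mul, mul_add, smul_mul_assoc, smul_mul_assoc, mul_smul_comm,
    smul_mul_assoc, Matrix.single_mul_single_same, Matrix.single_mul_single_of_ne _ _ _ _ hne]
  simp [sub_smul]

variable [Infinite F]

theorem upperGL_of_weight_zero (V : PolyRep.{u, v} F (n + 2)) (x : V.carrier)
    (hx : ∀ s, V.ρ (lastTorus (n + 1) s) x = x) (t : F) : V.ρ (upperGL n t) x = x := by
  obtain ⟨y, -, hy0, -, hexp, -⟩ := V.exists_expansion_of_weight _ (upperGL n) (upperGL_val n) _ _
    (lastTorus_val (n + 1)) lastTorus_mul_upperGL 0 x (by simpa using hx)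
  rw [hexp]
  simpa using hy0

theorem upperGL_of_weight_one (V : PolyRep.{u, v} F (n + 2)) (x : V.carrier)
    (hx : ∀ s, V.ρ (lastTorus (n + 1) s) x = (s : F) • x) (t : F) :
    V.ρ (upperGL n t) x =
      x + t • V.lieAct (Matrix.single (Fin.last n).castSucc (Fin.last (n + 1)) 1) x := by
  obtain ⟨y, -, hy0, hy1, hexp, -⟩ := V.exists_expansion_of_weight _ (upperGL n) (upperGL_val n) _
    _ (lastTorus_val (n + 1)) lastTorus_mul_upperGL 1 x (by simpa using hx)
  rw [hexp, Finset.sum_range_succ, Finset.sum_range_one, hy0, hy1, pow_zero, pow_one, one_smul]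

/-- A matrix unit shifts the eigenvalues of a group element which rescales it. -/
theorem diag_lieAct (V : PolyRep.{u, v} F n) (d : GL (Fin n) F) (a b : Fin n) (c e : F)
    (hd : d.val * Matrix.single a b 1 = (c • Matrix.single a b 1) * d.val) (x : V.carrier)
    (hx : V.ρ d x = e • x) :
    V.ρ d (V.lieAct (Matrix.single a b 1) x) = (e * c) • V.lieAct (Matrix.single a b 1) x := by
  rw [V.ρ_lieAct d hd, hx, map_smul, lieAct_smul, LinearMap.smul_apply, smul_smul]

/-- On vectors of weights `0` and `1` for the last two coordinates, `x_{n+2,n+1} x_{n+1,n+2}` is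
the identity. This accounts for the difference between the constants in `X_n` and `X_{n+1}`. -/
theorem lieAct_lieAct_of_weight_zero_one (V : PolyRep.{u, v} F (n + 2)) (x : V.carrier)
    (hq : ∀ s, V.ρ (lastTorus (n + 1) s) x = (s : F) • x)
    (hp : ∀ s, V.ρ (incl (n + 1) (lastTorus n s)) x = x) :
    V.lieAct (Matrix.single (Fin.last (n + 1)) (Fin.last n).castSucc 1)
      (V.lieAct (Matrix.single (Fin.last n).castSucc (Fin.last (n + 1)) 1) x) = x := by
  set w := V.lieAct (Matrix.single (Fin.last n).castSucc (Fin.last (n + 1)) 1) x with hw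
  have hwp : ∀ s, V.ρ (incl (n + 1) (lastTorus n s)) w = (s : F) • w := fun s => by
    have := V.diag_lieAct _ _ _ _ 1 (incl_lastTorus_mul_single s) x (by rw [hp, one_smul])
    rwa [one_mul] at this
  have hlow : ∀ (k : ℕ) (z : V.carrier),
      (∀ s, V.ρ (incl (n + 1) (lastTorus n s)) z = (s : F) ^ k • z) → _ := fun k z hz =>
    V.exists_expansion_of_weight _ (lowerGL n) (lowerGL_val n) _ _ (incl_lastTorus_val n)
      incl_lastTorus_mul_lowerGL k z hz
  obtain ⟨y, -, hy0, -, hexp, -⟩ := hlow 0 x (by simpa using hp)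
  obtain ⟨z, -, hz0, hz1, hexp', hconj⟩ := hlow 1 w (by simpa using hwp)
  have hzp : ∀ s, V.ρ (incl (n + 1) (lastTorus n s)) (z 1) = z 1 := fun s => by
    have := hconj _ _ _ (incl_lastTorus_mul_lowerGL s) (hwp s) 1
    simpa using this
  have hsq : ∀ s, V.ρ (lastTorus (n + 1) s) (V.ρ (sElt n) x) = V.ρ (sElt n) x := fun s => by
    rw [← Module.End.mul_apply, ← map_mul, ← sElt_mul_inner, map_mul, Module.End.mul_apply, hp]
  have hsp : ∀ s, V.ρ (incl (n + 1) (lastTorus n s)) (V.ρ (sElt n) x) =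
      (s : F) • V.ρ (sElt n) x := fun s => by
    rw [← Module.End.mul_apply, ← map_mul, ← sElt_mul_outer, map_mul, Module.End.mul_apply, hq,
      map_smul]
  have h1 : V.ρ (upperGL n 1) (V.ρ (sElt n) x) = V.ρ (lowerGL n 1) (V.ρ (upperGL n (-1)) x) := by
    rw [← Module.End.mul_apply, ← Module.End.mul_apply, ← map_mul, ← map_mul, upperGL_mul_sElt]
  rw [V.upperGL_of_weight_zero _ hsq, V.upperGL_of_weight_one x hq, ← hw, map_add, map_smul, hexp,
    hexp'] at h1
  simp only [Finset.sum_range_succ, Finset.sum_range_zero, zero_add, hy0, hz0, one_pow, one_smul,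
    neg_smul] at h1
  -- compare the parts of weight `0` for the last but one coordinate
  have h2 := coeff_eq_zero_of_sum_eq_zero (F := F) (K := 2)
    (fun k => if k = 0 then x - z 1 else - (V.ρ (sElt n) x + w)) (fun s => by
      have := congrArg (V.ρ (incl (n + 1) (lastTorus n s))) h1
      simp only [map_add, map_neg, hsp, hp, hwp, hzp] at this
      rw [← sub_eq_zero, ← neg_eq_zero] at this
      rw [← this]
      simp only [Finset.sum_range_succ, Finset.sum_range_zero, if_true, one_ne_zero, if_false]
      module) (k := 0) (by norm_num)
  rw [← hz1]
  exact (sub_eq_zero.1 h2).symm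

/-- On vectors of weight `1` for the last two coordinates the rotation `s_{n+1}` is
`1 - x_{n+2,n+1} x_{n+1,n+2}`. Both sides are read off from the factorization of the rotation in
unipotent matrices, by comparing parts of weight `1` for the last but one coordinate. -/
theorem lieAct_lieAct_of_weight_one_one (V : PolyRep.{u, v} F (n + 2)) (x : V.carrier)
    (hq : ∀ s, V.ρ (lastTorus (n + 1) s) x = (s : F) • x)
    (hp : ∀ s, V.ρ (incl (n + 1) (lastTorus n s)) x = (s : F) • x) :
    V.lieAct (Matrix.single (Fin.last (n + 1)) (Fin.last n).castSucc 1)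
      (V.lieAct (Matrix.single (Fin.last n).castSucc (Fin.last (n + 1)) 1) x) =
      x - V.ρ (sElt n) x := by
  set w := V.lieAct (Matrix.single (Fin.last n).castSucc (Fin.last (n + 1)) 1) x with hw
  have hup : ∀ z : V.carrier, (∀ s, V.ρ (incl (n + 1) (lastTorus n s)) z = (s : F) • z) → ∀ s,
      V.ρ (incl (n + 1) (lastTorus n s))
        (V.lieAct (Matrix.single (Fin.last n).castSucc (Fin.last (n + 1)) 1) z) =
      (s : F) ^ 2 • V.lieAct (Matrix.single (Fin.last n).castSucc (Fin.last (n + 1)) 1) z :=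
    fun z hz s => by
      rw [pow_two]
      exact V.diag_lieAct _ _ _ _ _ (incl_lastTorus_mul_single s) z (hz s)
  have hwp : ∀ s, V.ρ (incl (n + 1) (lastTorus n s)) w = (s : F) ^ 2 • w := hup x hp
  have hlow : ∀ (k : ℕ) (z : V.carrier),
      (∀ s, V.ρ (incl (n + 1) (lastTorus n s)) z = (s : F) ^ k • z) → _ := fun k z hz =>
    V.exists_expansion_of_weight _ (lowerGL n) (lowerGL_val n) _ _ (incl_lastTorus_val n)
      incl_lastTorus_mul_lowerGL k z hz
  obtain ⟨y, -, hy0, -, hexp, hconj⟩ := hlow 1 x (by simpa using hp)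
  obtain ⟨z, -, hz0, hz1, hexp', hconj'⟩ := hlow 2 w hwp
  have hy1 : ∀ s, V.ρ (incl (n + 1) (lastTorus n s)) (y 1) = y 1 := fun s => by
    have := hconj _ _ _ (incl_lastTorus_mul_lowerGL s) (hp s) 1
    simpa using this
  have hzp1 : ∀ s, V.ρ (incl (n + 1) (lastTorus n s)) (z 1) = (s : F) • z 1 := fun s => by
    have := hconj' _ _ _ (incl_lastTorus_mul_lowerGL s) (hwp s) 1
    simpa [pow_two] using this
  have hzp2 : ∀ s, V.ρ (incl (n + 1) (lastTorus n s)) (z 2) = z 2 := fun s => by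
    have := hconj' _ _ _ (incl_lastTorus_mul_lowerGL s) (hwp s) 2
    simpa [← mul_pow] using this
  have hsq : ∀ s, V.ρ (lastTorus (n + 1) s) (V.ρ (sElt n) x) = (s : F) • V.ρ (sElt n) x :=
    fun s => by
      rw [← Module.End.mul_apply, ← map_mul, ← sElt_mul_inner, map_mul, Module.End.mul_apply, hp,
        map_smul]
  have hsp : ∀ s, V.ρ (incl (n + 1) (lastTorus n s)) (V.ρ (sElt n) x) =
      (s : F) • V.ρ (sElt n) x := fun s => by
    rw [← Module.End.mul_apply, ← map_mul, ← sElt_mul_outer, map_mul, Module.End.mul_apply, hq,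
      map_smul]
  have hsw := hup _ hsp
  have h1 : V.ρ (upperGL n 1) (V.ρ (sElt n) x) = V.ρ (lowerGL n 1) (V.ρ (upperGL n (-1)) x) := by
    rw [← Module.End.mul_apply, ← Module.End.mul_apply, ← map_mul, ← map_mul, upperGL_mul_sElt]
  rw [V.upperGL_of_weight_one _ hsq, V.upperGL_of_weight_one x hq, ← hw, map_add, map_smul, hexp,
    hexp'] at h1
  simp only [Finset.sum_range_succ, Finset.sum_range_zero, zero_add, hy0, hz0, one_pow, one_smul,
    neg_smul] at h1
  set r := V.lieAct (Matrix.single (Fin.last n).castSucc (Fin.last (n + 1)) 1) (V.ρ (sElt n) x)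
  -- compare the parts of weight `1` for the last but one coordinate
  have h2 := coeff_eq_zero_of_sum_eq_zero (F := F) (K := 3)
    (fun k => if k = 0 then y 1 - z 2 else if k = 1 then x - z 1 - V.ρ (sElt n) x else - w - r)
    (fun s => by
      have := congrArg (V.ρ (incl (n + 1) (lastTorus n s))) h1
      simp only [map_add, map_neg, hsp, hsw, hp, hwp, hzp1, hzp2, hy1] at this
      rw [← sub_eq_zero, ← neg_eq_zero] at this
      rw [← this]
      simp only [Finset.sum_range_succ, Finset.sum_range_zero, if_true, one_ne_zero, if_false,
        OfNat.ofNat_ne_zero, OfNat.ofNat_ne_one]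
      module) (k := 1) (by norm_num)
  have h3 : x - z 1 - V.ρ (sElt n) x = 0 := h2
  rw [← hz1, ← sub_eq_zero.1 h3, sub_sub_cancel]

end RankTwo

end PolyRep

/-! ### Monomial matrices and the braid relation -/

section Monomial
variable {N : ℕ}

/-- The matrix of the linear map which sends the basis vector `v_j` to `ε j • v_{π j}`. -/
def monomialMatrix (π : Equiv.Perm (Fin N)) (ε : Fin N → Fˣ) : Matrix (Fin N) (Fin N) F :=
  Matrix.of fun i j => if i = π j then (ε j : F) else 0

theorem monomialMatrix_mul (π π' : Equiv.Perm (Fin N)) (ε ε' : Fin N → Fˣ) :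
    monomialMatrix π ε * monomialMatrix π' ε' =
      monomialMatrix (π * π') (fun j => ε (π' j) * ε' j) := by
  ext i j
  simp only [monomialMatrix, Matrix.mul_apply, Matrix.of_apply, Equiv.Perm.mul_apply]
  rw [Finset.sum_eq_single (π' j)]
  · simp only [if_true, ite_mul, zero_mul, Units.val_mul]
    congr
  · intro k _ hk
    rw [if_neg hk, mul_zero]
  · simp

theorem monomialMatrix_one : monomialMatrix (1 : Equiv.Perm (Fin N)) (fun _ => (1 : Fˣ)) = 1 := by
  ext i j
  simp only [monomialMatrix, Matrix.of_apply, Matrix.one_apply, Equiv.Perm.one_apply, Units.val_one]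
  congr

/-- The monomial matrix which sends the basis vector `v_j` to `ε j • v_{π j}`, as an element of the
general linear group. -/
def monomialGL (π : Equiv.Perm (Fin N)) (ε : Fin N → Fˣ) : GL (Fin N) F where
  val := monomialMatrix π ε
  inv := monomialMatrix π⁻¹ fun j => (ε (π⁻¹ j))⁻¹
  val_inv := by
    rw [monomialMatrix_mul, mul_inv_cancel, ← monomialMatrix_one]
    simp
  inv_val := by
    rw [monomialMatrix_mul, inv_mul_cancel, ← monomialMatrix_one]
    simp

theorem monomialGL_apply (π : Equiv.Perm (Fin N)) (ε : Fin N → Fˣ) (i j : Fin N) :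
    (monomialGL π ε).val i j = if i = π j then (ε j : F) else 0 := rfl

theorem monomialGL_mul (π π' : Equiv.Perm (Fin N)) (ε ε' : Fin N → Fˣ) :
    monomialGL π ε * monomialGL π' ε' = monomialGL (π * π') (fun j => ε (π' j) * ε' j) :=
  Units.ext (monomialMatrix_mul π π' ε ε')

theorem monomialGL_one : monomialGL (1 : Equiv.Perm (Fin N)) (fun _ => (1 : Fˣ)) = 1 :=
  Units.ext monomialMatrix_one

theorem monomialGL_mul_single (π : Equiv.Perm (Fin N)) (ε : Fin N → Fˣ) (a b : Fin N) :
    (monomialGL π ε).val * Matrix.single a b 1 =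
      (((ε a * (ε b)⁻¹ : Fˣ) : F) • Matrix.single (π a) (π b) 1) * (monomialGL π ε).val := by
  ext i j
  rw [smul_mul_assoc, Matrix.smul_apply, Matrix.mul_apply, Matrix.mul_apply,
    Finset.sum_eq_single a, Finset.sum_eq_single (π b)]
  · simp only [monomialGL_apply, Matrix.single_apply, EmbeddingLike.apply_eq_iff_eq]
    by_cases hi : i = π a <;> by_cases hj : b = j <;> simp [hi, hj, Ne.symm]
  · intro k _ hk
    rw [Matrix.single_apply_of_col_ne _ _ hk.symm, zero_mul]
  · simp
  · intro k _ hk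
    rw [Matrix.single_apply_of_row_ne hk.symm, mul_zero]
  · simp

/-- The function with the value `c` at `a` and the value `1` elsewhere. -/
def scaleAt (a : Fin N) (c : Fˣ) : Fin N → Fˣ := fun j => if j = a then c else 1

theorem incl_monomialGL_swap (a b c : Fin N) (t : Fˣ) :
    incl N (monomialGL (Equiv.swap a b) (scaleAt c t)) =
      monomialGL (Equiv.swap a.castSucc b.castSucc) (scaleAt c.castSucc t) := by
  have hl : ∀ k : Fin N, Fin.last N ≠ k.castSucc := fun k => (Fin.castSucc_lt_last k).ne'
  apply Units.ext
  ext i j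
  rw [monomialGL_apply]
  induction i using Fin.lastCases <;> induction j using Fin.lastCases
  · rw [PolyRep.incl_ll, Equiv.swap_apply_of_ne_of_ne (hl _) (hl _)]
    simp [scaleAt, hl]
  · rw [PolyRep.incl_lc, if_neg]
    simp only [Equiv.swap_apply_def]
    split_ifs <;> exact hl _
  · rw [PolyRep.incl_cl, Equiv.swap_apply_of_ne_of_ne (hl _) (hl _), if_neg (hl _).symm]
  · rw [PolyRep.incl_cc, monomialGL_apply]
    simp only [Equiv.swap_apply_def, scaleAt, Fin.castSucc_inj, ← apply_ite Fin.castSucc]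
    congr

theorem lastTorus_eq_monomialGL (n : ℕ) (t : Fˣ) :
    lastTorus n t = monomialGL 1 (scaleAt (Fin.last n) t) := by
  apply Units.ext
  ext i j
  rw [monomialGL_apply, PolyRep.lastTorus_val]
  by_cases h : i = j
  · subst h
    by_cases h' : Fin.last n = i
    · simp [scaleAt, ← h']
    · simp [scaleAt, h', Ne.symm h']
  · simp [h, Matrix.single_apply]
    grind

theorem sElt_eq_monomialGL (n : ℕ) : (sElt n : GL (Fin (n + 2)) F) =
    monomialGL (Equiv.swap (Fin.last n).castSucc (Fin.last (n + 1)))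
      (scaleAt (Fin.last (n + 1)) (-1)) := by
  have hp : (Fin.last n).castSucc = Fin.natAdd n (0 : Fin 2) := rfl
  have hq : Fin.last (n + 1) = Fin.natAdd n (1 : Fin 2) := rfl
  have hne : ∀ (i : Fin n) (j : Fin 2), Fin.castAdd 2 i ≠ Fin.natAdd n j := fun i j h => by
    have := congrArg Fin.val h
    simp at this
    omega
  apply Units.ext
  ext i j
  rw [monomialGL_apply, hp, hq]
  induction i using Fin.addCases with
  | left i =>
    induction j using Fin.addCases with
    | left j =>
      rw [sElt, PolyRep.blockGL_cc, Equiv.swap_apply_of_ne_of_ne (hne _ _) (hne _ _)]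
      simp [scaleAt, hne, Matrix.one_apply]
    | right j =>
      rw [sElt, PolyRep.blockGL_cn]
      simp only [Equiv.swap_apply_def]
      split_ifs <;> grind
  | right i =>
    induction j using Fin.addCases with
    | left j =>
      rw [sElt, PolyRep.blockGL_nc, Equiv.swap_apply_of_ne_of_ne (hne _ _) (hne _ _),
        if_neg (hne _ _).symm]
    | right j =>
      rw [sElt, PolyRep.blockGL_nn]
      fin_cases i <;> fin_cases j <;> simp [rot, scaleAt, Fin.ext_iff]

/-- The braid relation. -/
theorem sElt_braid (n : ℕ) :
    incl (n + 2) (sElt n) * sElt (n + 1) * incl (n + 2) (sElt n) =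
      sElt (n + 1) * incl (n + 2) (sElt n) * (sElt (n + 1) : GL (Fin (n + 3)) F) := by
  rw [sElt_eq_monomialGL, sElt_eq_monomialGL, incl_monomialGL_swap]
  simp only [monomialGL_mul]
  have h1 : (Fin.last n).castSucc.castSucc ≠ (Fin.last (n + 1)).castSucc := by
    simp [Fin.ext_iff]
  have h2 : (Fin.last n).castSucc.castSucc ≠ (Fin.last (n + 2)) := by
    simp [Fin.ext_iff]
  have h3 : (Fin.last (n + 1)).castSucc ≠ (Fin.last (n + 2)) := by
    simp [Fin.ext_iff]
  generalize (Fin.last n).castSucc.castSucc = a at *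
  generalize (Fin.last (n + 1)).castSucc = b at *
  generalize Fin.last (n + 2) = c at *
  congr 1
  · ext j : 1
    simp only [Equiv.Perm.mul_apply, Equiv.swap_apply_def]
    grind
  · ext j : 1
    simp only [Equiv.swap_apply_def, scaleAt]
    grind

end Monomial

/-! ### The operators `X_n` and the rotations `s_{n+1}` -/

namespace PolyRep

section MatrixUnits
variable {N : ℕ}

theorem single_mul_eq_sum (a b : Fin N) (M : Matrix (Fin N) (Fin N) F) :
    Matrix.single a b 1 * M = ∑ j, M b j • Matrix.single a j 1 := by
  ext i k
  simp only [Matrix.mul_apply, Matrix.single_apply, Matrix.sum_apply, Matrix.smul_apply]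
  by_cases h : a = i <;> simp [h]

theorem mul_single_eq_sum (a b : Fin N) (M : Matrix (Fin N) (Fin N) F) :
    M * Matrix.single a b 1 = ∑ i, M i a • Matrix.single i b 1 := by
  ext i k
  simp only [Matrix.mul_apply, Matrix.single_apply, Matrix.sum_apply, Matrix.smul_apply]
  by_cases h : b = k <;> simp [h]

end MatrixUnits

variable {n : ℕ}

theorem opX_apply (V : PolyRep.{u, v} F (n + 1)) (x : V.carrier) :
    V.opX x = ∑ i : Fin n, V.lieAct (Matrix.single (Fin.last n) i.castSucc 1)
      (V.lieAct (Matrix.single i.castSucc (Fin.last n) 1) x) - (n : F) • x := by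
  simp [opX, LinearMap.sum_apply]

theorem incl_mul_single_last (g : GL (Fin n) F) (i : Fin n) :
    (incl n g).val * Matrix.single (Fin.last n) i.castSucc 1 =
      (∑ j, (g⁻¹).val i j • Matrix.single (Fin.last n) j.castSucc 1) * (incl n g).val := by
  rw [mul_single_eq_sum, Fin.sum_univ_castSucc, Finset.sum_mul]
  simp only [incl_cl, incl_ll, zero_smul, Finset.sum_const_zero, zero_add, one_smul,
    smul_mul_assoc, single_mul_eq_sum, Fin.sum_univ_castSucc, incl_cc, add_zero,
    Finset.smul_sum, smul_smul]
  rw [Finset.sum_comm]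
  simp only [← Finset.sum_smul, ← Matrix.mul_apply, Units.inv_mul, Matrix.one_apply, ite_smul,
    one_smul, zero_smul, Finset.sum_ite_eq, Finset.mem_univ, if_true]

theorem incl_mul_single_castSucc (g : GL (Fin n) F) (i : Fin n) :
    (incl n g).val * Matrix.single i.castSucc (Fin.last n) 1 =
      (∑ k, g.val k i • Matrix.single k.castSucc (Fin.last n) 1) * (incl n g).val := by
  rw [mul_single_eq_sum, Fin.sum_univ_castSucc, Finset.sum_mul]
  simp only [incl_cc, incl_lc, incl_ll, zero_smul, Finset.sum_const_zero, zero_add, one_smul,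
    smul_mul_assoc, single_mul_eq_sum, Fin.sum_univ_castSucc, add_zero]

theorem lastTorus_mul_single_last (t : Fˣ) (i : Fin n) :
    (lastTorus n t).val * Matrix.single (Fin.last n) i.castSucc 1 =
      ((t : F) • Matrix.single (Fin.last n) i.castSucc 1) * (lastTorus n t).val := by
  rw [lastTorus_eq_monomialGL, monomialGL_mul_single]
  simp [scaleAt]

theorem lastTorus_mul_single_castSucc (t : Fˣ) (i : Fin n) :
    (lastTorus n t).val * Matrix.single i.castSucc (Fin.last n) 1 =
      (((t⁻¹ : Fˣ) : F) • Matrix.single i.castSucc (Fin.last n) 1) * (lastTorus n t).val := by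
  rw [lastTorus_eq_monomialGL, monomialGL_mul_single]
  simp [scaleAt]

theorem swap_last_castSucc (i : Fin n) :
    Equiv.swap (Fin.last n).castSucc (Fin.last (n + 1)) i.castSucc.castSucc =
      i.castSucc.castSucc := by
  refine Equiv.swap_apply_of_ne_of_ne ?_ (Fin.castSucc_lt_last _).ne
  rw [Ne, Fin.castSucc_inj]
  exact (Fin.castSucc_lt_last _).ne

theorem sElt_mul_single_row (i : Fin n) :
    (sElt n : GL (Fin (n + 2)) F).val *
        Matrix.single (Fin.last n).castSucc i.castSucc.castSucc 1 =
      Matrix.single (Fin.last (n + 1)) i.castSucc.castSucc 1 * (sElt n).val := by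
  rw [sElt_eq_monomialGL, monomialGL_mul_single, swap_last_castSucc, Equiv.swap_apply_left]
  simp [scaleAt, (Fin.castSucc_lt_last _).ne]

theorem sElt_mul_single_col (i : Fin n) :
    (sElt n : GL (Fin (n + 2)) F).val *
        Matrix.single i.castSucc.castSucc (Fin.last n).castSucc 1 =
      Matrix.single i.castSucc.castSucc (Fin.last (n + 1)) 1 * (sElt n).val := by
  rw [sElt_eq_monomialGL, monomialGL_mul_single, swap_last_castSucc, Equiv.swap_apply_left]
  simp [scaleAt, (Fin.castSucc_lt_last _).ne]

theorem mem_R_one {V : PolyRep.{u, v} F (n + 1)} (x : (V.R 1).carrier) (s : Fˣ) :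
    V.ρ (lastTorus n s) x.1 = (s : F) • x.1 := by
  have := x.2 s
  rwa [zpow_one] at this

theorem mem_R_R_one {V : PolyRep.{u, v} F (n + 2)} {i : ℤ} (x : ((V.R i).R 1).carrier) (s : Fˣ) :
    V.ρ (incl (n + 1) (lastTorus n s)) x.1.1 = (s : F) • x.1.1 :=
  congrArg Subtype.val (mem_R_one x s)

theorem sElt_mul_sElt : sElt n * sElt n =
    lastTorus (n + 1) (-1) * incl (n + 1) (lastTorus n (-1 : Fˣ)) := by
  rw [lastTorus_eq, incl_lastTorus_eq]
  refine blockGL_mul_eq ?_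
  rw [blockGL_right_val, blockGL_left_val]
  simp [rot]

/-- The square of `s_{n+1}` is the diagonal matrix with the last two entries `-1`, which acts on
weight `(1, 1)` by `(-1) * (-1) = 1`. -/
theorem ρ_sElt_sElt (V : PolyRep.{u, v} F (n + 2)) (x : V.carrier)
    (hq : ∀ s, V.ρ (lastTorus (n + 1) s) x = (s : F) • x)
    (hp : ∀ s, V.ρ (incl (n + 1) (lastTorus n s)) x = (s : F) • x) :
    V.ρ (sElt n) (V.ρ (sElt n) x) = x := by
  rw [← Module.End.mul_apply, ← map_mul, sElt_mul_sElt, map_mul, Module.End.mul_apply, hp,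
    map_smul, hq]
  simp

variable [Infinite F]

/-- The operator `X_n` commutes with `G_n`: the sum in it is the contraction of the dual bases
`x_{i,n+1}` and `x_{n+1,i}` of the standard representation of `G_n` and its dual. -/
theorem ρ_incl_opX (V : PolyRep.{u, v} F (n + 1)) (g : GL (Fin n) F) (x : V.carrier) :
    V.ρ (incl n g) (V.opX x) = V.opX (V.ρ (incl n g) x) := by
  rw [opX_apply, opX_apply, map_sub, map_smul, map_sum]
  congr 1
  simp only [V.ρ_lieAct _ (incl_mul_single_last g _), V.ρ_lieAct _ (incl_mul_single_castSucc g _),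
    lieAct_sum, lieAct_smul, LinearMap.sum_apply, LinearMap.smul_apply, map_sum, map_smul,
    Finset.smul_sum, smul_smul]
  rw [Finset.sum_comm]
  have h : ∀ j k : Fin n, ∑ i, g.val j i * (g⁻¹).val i k =
      (1 : Matrix (Fin n) (Fin n) F) j k := fun j k => by
    rw [← Units.mul_inv g, Matrix.mul_apply]
  have h' : ∀ j : Fin n, ∑ i, ∑ k, (g.val j i * (g⁻¹).val i k) •
      V.lieAct (Matrix.single (Fin.last n) k.castSucc 1)
        (V.lieAct (Matrix.single j.castSucc (Fin.last n) 1) (V.ρ (incl n g) x)) =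
      V.lieAct (Matrix.single (Fin.last n) j.castSucc 1)
        (V.lieAct (Matrix.single j.castSucc (Fin.last n) 1) (V.ρ (incl n g) x)) := fun j => by
    rw [Finset.sum_comm]
    simp only [← Finset.sum_smul, h, Matrix.one_apply, ite_smul, one_smul, zero_smul,
      Finset.sum_ite_eq, Finset.mem_univ, if_true]
  exact Finset.sum_congr rfl fun j _ => h' j

theorem ρ_lastTorus_opX (V : PolyRep.{u, v} F (n + 1)) (t : Fˣ) (x : V.carrier) :
    V.ρ (lastTorus n t) (V.opX x) = V.opX (V.ρ (lastTorus n t) x) := by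
  rw [opX_apply, opX_apply, map_sub, map_smul, map_sum]
  congr 1
  refine Finset.sum_congr rfl fun i _ => ?_
  rw [V.ρ_lieAct _ (lastTorus_mul_single_last t i),
    V.ρ_lieAct _ (lastTorus_mul_single_castSucc t i), lieAct_smul, lieAct_smul,
    LinearMap.smul_apply, LinearMap.smul_apply, map_smul, smul_smul, Units.mul_inv, one_smul]

theorem map_opX {V W : PolyRep.{u, v} F (n + 1)} (f : Representation.IntertwiningMap V.ρ W.ρ)
    (x : V.carrier) : f (V.opX x) = W.opX (f x) := by
  simp only [opX_apply, map_sub, map_sum, map_smul, map_lieAct]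

theorem opX_mem (V : PolyRep.{u, v} F (n + 1)) (i : ℤ) (x : V.carrier)
    (hx : x ∈ V.weightSpace i) : V.opX x ∈ V.weightSpace i := fun t => by
  rw [ρ_lastTorus_opX, hx t, map_smul]

/-- The operator `X_n` as an endomorphism of the representation `R_i V` of `G_n`. -/
def opXR (V : PolyRep.{u, v} F (n + 1)) (i : ℤ) :
    Representation.IntertwiningMap (V.R i).ρ (V.R i).ρ where
  toLinearMap := V.opX.restrict (V.opX_mem i)
  isIntertwining' g := LinearMap.ext fun x => Subtype.ext (V.ρ_incl_opX g x.1).symm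

/-- The conjugate by `s_{n+1}` of the operator `X_n` of `G_{n+1}` is the operator `X_{n+1}` of
`G_{n+2}` without the summand of index `n + 1`, and with the constant `n` instead of `n + 1`. -/
theorem ρ_sElt_opX (V : PolyRep.{u, v} F (n + 2)) (i : ℤ) (z : (V.R i).carrier) :
    V.ρ (sElt n) (V.inclR i ((V.R i).opX z)) =
      V.opX (V.ρ (sElt n) (V.inclR i z)) + V.ρ (sElt n) (V.inclR i z) -
        V.lieAct (Matrix.single (Fin.last (n + 1)) (Fin.last n).castSucc 1)
          (V.lieAct (Matrix.single (Fin.last n).castSucc (Fin.last (n + 1)) 1)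
            (V.ρ (sElt n) (V.inclR i z))) := by
  rw [opX_apply, opX_apply, Fin.sum_univ_castSucc]
  simp only [map_sub, map_smul, map_sum, inclR_lieAct, V.ρ_lieAct _ (sElt_mul_single_row _),
    V.ρ_lieAct _ (sElt_mul_single_col _)]
  push_cast
  module

/-- The relation `T ∘ XE - EX ∘ T = 1` on vectors. -/
theorem ρ_sElt_opX_sub (V : PolyRep.{u, v} F (n + 2)) (x : ((V.R 1).R 1).carrier) :
    V.ρ (sElt n) (V.inclR 1 ((V.R 1).opX x.1)) - V.opX (V.ρ (sElt n) x.1.1) = x.1.1 := by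
  have hx : V.inclR 1 x.1 = x.1.1 := rfl
  rw [ρ_sElt_opX, hx, lieAct_lieAct_of_weight_one_one, ρ_sElt_sElt _ _ (mem_R_one x.1)
    (mem_R_R_one x)]
  · abel
  · exact mem_R_one (V.swap 1 1 x).1
  · exact mem_R_R_one (V.swap 1 1 x)

end PolyRep

theorem conj_of_braid {G : Type*} [Group G] {a b : G} (h : a * b * a = b * a * b) :
    a * (b⁻¹ * a⁻¹) = b⁻¹ * (a⁻¹ * b) := by
  calc a * (b⁻¹ * a⁻¹) = b⁻¹ * a⁻¹ * (a * b * a) * b⁻¹ * a⁻¹ := by group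
    _ = b⁻¹ * (a⁻¹ * b) := by rw [h]; group

/-! ### The natural transformations `X` and `T` -/

namespace StabObj
open PolyRep

/-- The natural transformation `T : E² ⟶ E²`, acting on `R_1 (R_1 (V_{n+2}))` by `s_{n+1}`. -/
def T : (E ⋙ E : StabObj.{u, v} F ⥤ StabObj.{u, v} F) ⟶ E ⋙ E where
  app V :=
    { app := fun n => ((V.V (n + 2)).swap 1 1).toIntertwiningMap
      comm := fun n => by
        apply Representation.IntertwiningMap.ext
        ext x
        apply Subtype.ext
        apply Subtype.ext
        -- the gluing map sends `x` to `α z`, where `z = s_{n+2}⁻¹ s_{n+1}⁻¹ x`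
        let y := (((E.obj V).V (n + 2)).swap 1 0).symm x
        let z : ((V.V (n + 3)).R 0).carrier := (((V.V (n + 3)).swap 1 0).symm y.1).1
        refine (Representation.IntertwiningMap.isIntertwining _ _ (V.α (n + 2)).toIntertwiningMap
          (sElt n) z).symm.trans ?_
        refine congrArg (V.α (n + 2)) (Subtype.ext ?_)
        change (V.V (n + 3)).ρ (incl (n + 2) (sElt n)) ((V.V (n + 3)).ρ (sElt (n + 1))⁻¹
            ((V.V (n + 3)).ρ (incl (n + 2) (sElt n)⁻¹) x.1.1.1)) =
          (V.V (n + 3)).ρ (sElt (n + 1))⁻¹ ((V.V (n + 3)).ρ (incl (n + 2) (sElt n)⁻¹)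
            ((V.V (n + 3)).ρ (sElt (n + 1)) x.1.1.1))
        simp only [← Module.End.mul_apply, ← map_mul, map_inv]
        rw [conj_of_braid (sElt_braid n)] }
  naturality V W f := by
    apply hom_ext
    intro n
    apply Representation.IntertwiningMap.ext
    ext x
    refine Subtype.ext (Subtype.ext ?_)
    exact (Representation.IntertwiningMap.isIntertwining _ _ (f.app (n + 2)) (sElt n) x.1.1).symm

theorem T_comp_T : (T ≫ T : (E ⋙ E : StabObj.{u, v} F ⥤ StabObj.{u, v} F) ⟶ E ⋙ E) = 𝟙 _ := by
  refine NatTrans.ext (funext fun V => ?_)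
  apply hom_ext
  intro n
  apply Representation.IntertwiningMap.ext
  ext x
  refine Subtype.ext (Subtype.ext ?_)
  change (V.V (n + 2)).ρ (sElt n) ((V.V (n + 2)).ρ (sElt n) x.1.1) = x.1.1
  exact (V.V (n + 2)).ρ_sElt_sElt x.1.1 (mem_R_one x.1) (mem_R_R_one x)

variable [Infinite F]

/-- The natural transformation `X : E ⟶ E`, acting on `R_1 (V_{n+1})` by `X_n`. -/
def X : (E : StabObj.{u, v} F ⥤ StabObj.{u, v} F) ⟶ E where
  app V :=
    { app := fun n => (V.V (n + 1)).opXR 1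
      comm := fun n => by
        apply Representation.IntertwiningMap.ext
        ext x
        apply Subtype.ext
        -- the gluing map sends `x` to `α z`, where `z = s_{n+1}⁻¹ x`
        let z : ((V.V (n + 2)).R 0).carrier := (((V.V (n + 2)).swap 1 0).symm x).1
        have hz : (V.V (n + 2)).ρ (sElt n) ((V.V (n + 2)).inclR 0 z) = x.1.1 :=
          (V.V (n + 2)).ρ.self_inv_apply (sElt n) x.1.1
        refine (map_opX (V.α (n + 1)).toIntertwiningMap z).symm.trans ?_
        refine congrArg (V.α (n + 1)) (Subtype.ext ?_)
        change (V.V (n + 2)).inclR 0 (((V.V (n + 2)).R 0).opX z) =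
          (V.V (n + 2)).ρ (sElt n)⁻¹ ((V.V (n + 2)).opX x.1.1)
        have hx : ∀ s, (V.V (n + 2)).ρ (incl (n + 1) (lastTorus n s)) x.1.1 = x.1.1 := fun s => by
          have := congrArg Subtype.val (x.2 s)
          rw [zpow_zero, Units.val_one, one_smul] at this
          exact this
        have hx' : ∀ s, (V.V (n + 2)).ρ (lastTorus (n + 1) s) x.1.1 = (s : F) • x.1.1 := fun s => by
          have := x.1.2 s
          rwa [zpow_one] at this
        have h := (V.V (n + 2)).ρ_sElt_opX 0 z
        rw [hz, lieAct_lieAct_of_weight_zero_one _ _ hx' hx, add_sub_cancel_right] at h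
        rw [← h, Representation.inv_self_apply] }
  naturality V W f := by
    apply hom_ext
    intro n
    apply Representation.IntertwiningMap.ext
    ext x
    exact Subtype.ext (map_opX (f.app (n + 1)) x.1).symm

theorem X_T_relation : Functor.whiskerLeft E X ≫ T - T ≫ Functor.whiskerRight X E =
    𝟙 (E ⋙ E : StabObj.{u, v} F ⥤ StabObj.{u, v} F) := by
  refine NatTrans.ext (funext fun V => ?_)
  apply hom_ext
  intro n
  apply Representation.IntertwiningMap.ext
  ext x
  refine Subtype.ext (Subtype.ext ?_)
  change (V.V (n + 2)).ρ (sElt n) ((V.V (n + 2)).inclR 1 (((V.V (n + 2)).R 1).opX x.1)) -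
    (V.V (n + 2)).opX ((V.V (n + 2)).ρ (sElt n) x.1.1) = x.1.1
  exact (V.V (n + 2)).ρ_sElt_opX_sub x

end StabObj

/-! ### The relations between the endomorphisms of `E^m` -/

namespace StabObj

open PolyRep

/-- The endomorphism `E f` of `E ∘ G`, for an endomorphism `f` of `G`. -/
def whiskerE {G : StabObj.{u, v} F ⥤ StabObj.{u, v} F} (f : End G) : End (G ⋙ E) :=
  Functor.whiskerRight f E

section YTau
variable (X : (E : StabObj.{u, v} F ⥤ StabObj.{u, v} F) ⟶ E)
  (T : (E ⋙ E : StabObj.{u, v} F ⥤ StabObj.{u, v} F) ⟶ E ⋙ E)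

theorem yE_last (m : ℕ) : yE X (m + 1) (Fin.last m) = Functor.whiskerLeft (Epow m) X :=
  Fin.lastCases_last ..

theorem yE_castSucc (m : ℕ) (i : Fin m) :
    yE X (m + 1) i.castSucc = whiskerE (yE X m i) :=
  Fin.lastCases_castSucc ..

theorem tauE_last_app (m : ℕ) (V : StabObj.{u, v} F) :
    (tauE T (m + 2) (Fin.last m)).app V = T.app ((Epow m).obj V) := by
  have : tauE T (m + 2) (Fin.last m) = (Functor.associator (Epow m) E E).hom ≫
      Functor.whiskerLeft (Epow m) T ≫ (Functor.associator (Epow m) E E).inv :=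
    Fin.lastCases_last ..
  rw [this]
  exact (Category.id_comp _).trans (Category.comp_id _)

theorem tauE_castSucc (m : ℕ) (i : Fin m) :
    tauE T (m + 2) i.castSucc = whiskerE (tauE T (m + 1) i) :=
  Fin.lastCases_castSucc ..

theorem whiskerE_mul {G : StabObj.{u, v} F ⥤ StabObj.{u, v} F} (f g : End G) :
    whiskerE (f * g) = whiskerE f * whiskerE g :=
  Functor.whiskerRight_comp g f E

theorem commute_whiskerE {G : StabObj.{u, v} F ⥤ StabObj.{u, v} F} {f g : End G}
    (h : Commute f g) : Commute (whiskerE f) (whiskerE g) := by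
  rw [commute_iff_eq, ← whiskerE_mul, ← whiskerE_mul, h.eq]

/-- The naturality of `X`, as a commutation relation. -/
theorem commute_yE_last (m : ℕ) (f : End (Epow.{u, v} (F := F) m)) :
    Commute (yE X (m + 1) (Fin.last m)) (whiskerE f) := by
  rw [yE_last]
  exact NatTrans.ext (funext fun V => X.naturality (f.app V))

theorem commute_yE (m : ℕ) (i j : Fin m) : Commute (yE X m i) (yE X m j) := by
  induction m with
  | zero => exact i.elim0
  | succ m ih =>
    induction i using Fin.lastCases with
    | last =>
      induction j using Fin.lastCases with
      | last => exact Commute.refl _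
      | cast j => rw [yE_castSucc]; exact commute_yE_last X m _
    | cast i =>
      induction j using Fin.lastCases with
      | last => rw [yE_castSucc]; exact (commute_yE_last X m _).symm
      | cast j => rw [yE_castSucc, yE_castSucc]; exact commute_whiskerE (ih i j)

theorem commute_tauE_yE (m : ℕ) (i : Fin (m - 1)) (j : Fin m) (h : (j : ℕ) ≠ i)
    (h' : (j : ℕ) ≠ i + 1) : Commute (tauE T m i) (yE X m j) := by
  induction m with
  | zero => exact j.elim0
  | succ m ih =>
    cases m with
    | zero => exact i.elim0
    | succ m =>
      change Fin (m + 1) at i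
      induction i using Fin.lastCases with
      | last =>
        induction j using Fin.lastCases with
        | last => exact absurd rfl h'
        | cast j =>
          induction j using Fin.lastCases with
          | last => exact absurd rfl h
          | cast j =>
            -- the naturality of `T`
            rw [yE_castSucc, yE_castSucc]
            refine NatTrans.ext (funext fun V => ?_)
            have := T.naturality ((yE X m j).app V)
            rw [← tauE_last_app] at this
            exact this
      | cast i =>
        rw [tauE_castSucc]
        induction j using Fin.lastCases with
        | last => exact (commute_yE_last X (m + 1) _).symm
        | cast j =>
          rw [yE_castSucc]
          exact commute_whiskerE (ih i j h h')

theorem tauE_mul_yE_last (hXT : Functor.whiskerLeft E X ≫ T - T ≫ Functor.whiskerRight X E = 𝟙 _)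
    (m : ℕ) :
    tauE T (m + 2) (Fin.last m) * yE X (m + 2) (Fin.last (m + 1)) =
      yE X (m + 2) (Fin.last m).castSucc * tauE T (m + 2) (Fin.last m) + 1 := by
  have hXT' : Functor.whiskerLeft E X ≫ T = T ≫ Functor.whiskerRight X E + 𝟙 (E ⋙ E) := by
    rw [← hXT, add_sub_cancel]
  rw [yE_castSucc, yE_last, yE_last]
  refine NatTrans.ext (funext fun V => ?_)
  have h : (Functor.whiskerLeft E X).app ((Epow m).obj V) ≫ T.app ((Epow m).obj V) =
      T.app ((Epow m).obj V) ≫ (Functor.whiskerRight X E).app ((Epow m).obj V) +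
        (𝟙 (E ⋙ E) : E ⋙ E ⟶ E ⋙ E).app ((Epow m).obj V) :=
    congrArg (fun f => NatTrans.app f ((Epow m).obj V)) hXT'
  rw [← tauE_last_app T] at h
  exact h

theorem tauE_mul_yE_sub (hXT : Functor.whiskerLeft E X ≫ T - T ≫ Functor.whiskerRight X E = 𝟙 _)
    (m : ℕ) (i : Fin (m - 1)) :
    tauE T m i * yE X m ⟨i + 1, by omega⟩ - yE X m ⟨i, by omega⟩ * tauE T m i = 1 := by
  induction m with
  | zero => exact i.elim0
  | succ m ih =>
    cases m with
    | zero => exact i.elim0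
    | succ m =>
      change Fin (m + 1) at i
      induction i using Fin.lastCases with
      | last =>
        have h1 : (⟨(Fin.last m : ℕ) + 1, by simp⟩ : Fin (m + 2)) = Fin.last (m + 1) := rfl
        have h0 : (⟨(Fin.last m : ℕ), by simp⟩ : Fin (m + 2)) = (Fin.last m).castSucc := rfl
        rw [h1, h0, tauE_mul_yE_last X T hXT, add_sub_cancel_left]
      | cast i =>
        have h1 : (⟨(i.castSucc : ℕ) + 1, by simp⟩ : Fin (m + 2)) =
          (⟨(i : ℕ) + 1, by simp⟩ : Fin (m + 1)).castSucc := rfl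
        have h0 : (⟨(i.castSucc : ℕ), by have := i.2; simp; omega⟩ : Fin (m + 2)) =
          (⟨(i : ℕ), by omega⟩ : Fin (m + 1)).castSucc := rfl
        rw [h1, h0, tauE_castSucc, yE_castSucc, yE_castSucc]
        have := congrArg (fun f => whiskerE f) (ih i)
        refine Eq.trans ?_ (this.trans (Functor.whiskerRight_id' E))
        rfl

end YTau

/-! ### The symmetric group acting on `E^m` -/

/-- The number `m + n`, in the form in which it arises from iterating the functor `E`: the
space `E^m(V)_n` lies in `V_{level m n}`. -/
def level : ℕ → ℕ → ℕ
  | 0, n => n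
  | m + 1, n => level m (n + 1)

/-- The embedding of the first `n` indices in all `level m n` indices. -/
def firstIdx : ∀ m n : ℕ, Fin n → Fin (level m n)
  | 0, _, a => a
  | m + 1, n, a => firstIdx m (n + 1) a.castSucc

/-- The index of the coordinate subgroup `G_1` for the `i`-th factor of `E^m`. The first factor
belongs to the last index. -/
def torusIdx : ∀ m n : ℕ, Fin m → Fin (level m n)
  | 0, _ => Fin.elim0
  | m + 1, n => Fin.lastCases (motive := fun _ => Fin (level (m + 1) n))
      (firstIdx m (n + 1) (Fin.last n)) (torusIdx m (n + 1))

/-- The inclusion `G_n ⊆ G_{n+m}`. -/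
def inclPow : ∀ m n : ℕ, GL (Fin n) F →* GL (Fin (level m n)) F
  | 0, _ => MonoidHom.id _
  | m + 1, n => (inclPow m (n + 1)).comp (incl n)

/-- The inclusion of `E^m(V)_n` in `V_{n+m}`. -/
def inclE (V : StabObj.{u, v} F) : ∀ m n : ℕ,
    (((Epow m).obj V).V n).carrier →ₗ[F] (V.V (level m n)).carrier
  | 0, _ => LinearMap.id
  | m + 1, n => (inclE V m (n + 1)).comp ((((Epow m).obj V).V (n + 1)).inclR 1)

theorem torusIdx_last (m n : ℕ) :
    torusIdx (m + 1) n (Fin.last m) = firstIdx m (n + 1) (Fin.last n) :=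
  Fin.lastCases_last ..

theorem torusIdx_castSucc (m n : ℕ) (i : Fin m) :
    torusIdx (m + 1) n i.castSucc = torusIdx m (n + 1) i :=
  Fin.lastCases_castSucc ..

theorem firstIdx_val (m n : ℕ) (a : Fin n) : (firstIdx m n a : ℕ) = a := by
  induction m generalizing n with
  | zero => rfl
  | succ m ih => exact ih (n + 1) a.castSucc

theorem torusIdx_val (m n : ℕ) (i : Fin m) : (torusIdx m n i : ℕ) + i + 1 = n + m := by
  induction m generalizing n with
  | zero => exact i.elim0
  | succ m ih =>
    induction i using Fin.lastCases with
    | last => rw [torusIdx_last, firstIdx_val]; simp; omega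
    | cast i => rw [torusIdx_castSucc, Fin.val_castSucc]; have := ih (n + 1) i; omega

theorem torusIdx_injective (m n : ℕ) : Function.Injective (torusIdx m n) := fun i j h => by
  have hi := torusIdx_val m n i
  have hj := torusIdx_val m n j
  rw [h] at hi
  exact Fin.ext (by omega)

theorem inclE_injective (V : StabObj.{u, v} F) (m n : ℕ) : Function.Injective (inclE V m n) := by
  induction m generalizing n with
  | zero => exact Function.injective_id
  | succ m ih => exact (ih (n + 1)).comp Subtype.val_injective

theorem inclE_ρ (V : StabObj.{u, v} F) (m n : ℕ) (g : GL (Fin n) F)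
    (x : (((Epow m).obj V).V n).carrier) :
    inclE V m n ((((Epow m).obj V).V n).ρ g x) =
      (V.V (level m n)).ρ (inclPow m n g) (inclE V m n x) := by
  induction m generalizing n with
  | zero => rfl
  | succ m ih => exact ih (n + 1) (incl n g) x.1

theorem inclPow_monomialGL_swap (m n : ℕ) (a b c : Fin n) (t : Fˣ) :
    inclPow m n (monomialGL (Equiv.swap a b) (scaleAt c t)) =
      monomialGL (Equiv.swap (firstIdx m n a) (firstIdx m n b)) (scaleAt (firstIdx m n c) t) := by
  induction m generalizing n with
  | zero => rfl
  | succ m ih =>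
    change inclPow m (n + 1) (incl n _) = _
    rw [incl_monomialGL_swap, ih]
    rfl

/-- The subspace `E^m(V)_n` of `V_{n+m}` is of weight `1` for each of the last `m` coordinate
subgroups `G_1`. -/
theorem torusIdx_weight (V : StabObj.{u, v} F) (m n : ℕ) (i : Fin m) (t : Fˣ)
    (x : (((Epow m).obj V).V n).carrier) :
    (V.V (level m n)).ρ (monomialGL 1 (scaleAt (torusIdx m n i) t)) (inclE V m n x) =
      (t : F) • inclE V m n x := by
  induction m generalizing n with
  | zero => exact i.elim0
  | succ m ih =>
    induction i using Fin.lastCases with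
    | last =>
      have h := inclE_ρ V m (n + 1) (lastTorus n t) x.1
      have h1 : (1 : Equiv.Perm (Fin (n + 1))) = Equiv.swap (Fin.last n) (Fin.last n) :=
        (Equiv.swap_self _).symm
      rw [mem_R_one (V := ((Epow m).obj V).V (n + 1)) x t, map_smul, lastTorus_eq_monomialGL, h1,
        inclPow_monomialGL_swap, Equiv.swap_self] at h
      rw [torusIdx_last]
      exact h.symm
    | cast i =>
      rw [torusIdx_castSucc]
      exact ih (n + 1) i x.1

/-- The endomorphism `tauE T m i` acts on `E^m(V)_n` by a signed permutation matrix
of `G_{n+m}`. -/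
theorem inclE_tauE (V : StabObj.{u, v} F) (m n : ℕ) (i : Fin (m - 1))
    (x : (((Epow m).obj V).V n).carrier) :
    inclE V m n (((tauE T m i).app V).app n x) =
      (V.V (level m n)).ρ (monomialGL
        (Equiv.swap (torusIdx m n ⟨i, by omega⟩) (torusIdx m n ⟨i + 1, by omega⟩))
        (scaleAt (torusIdx m n ⟨i, by omega⟩) (-1))) (inclE V m n x) := by
  induction m generalizing n with
  | zero => exact i.elim0
  | succ m ih =>
    cases m with
    | zero => exact i.elim0
    | succ m =>
      change Fin (m + 1) at i
      induction i using Fin.lastCases with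
      | last =>
        have h1 : (⟨(Fin.last m : ℕ) + 1, by simp⟩ : Fin (m + 2)) = Fin.last (m + 1) := rfl
        have h0 : (⟨(Fin.last m : ℕ), by simp⟩ : Fin (m + 2)) = (Fin.last m).castSucc := rfl
        have h := inclE_ρ V m (n + 2) (sElt n) x.1.1
        have h2 : inclPow m (n + 2) (sElt n : GL (Fin (n + 2)) F) = monomialGL
            (Equiv.swap (firstIdx m (n + 2) (Fin.last (n + 1)))
              (firstIdx m (n + 2) (Fin.last n).castSucc))
            (scaleAt (firstIdx m (n + 2) (Fin.last (n + 1))) (-1)) := by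
          rw [sElt_eq_monomialGL, inclPow_monomialGL_swap, Equiv.swap_comm]
        rw [h2] at h
        rw [h1, h0, torusIdx_castSucc, torusIdx_last, torusIdx_last]
        rw [tauE_last_app]
        exact h
      | cast i =>
        have h1 : (⟨(i.castSucc : ℕ) + 1, by simp⟩ : Fin (m + 2)) =
          (⟨(i : ℕ) + 1, by simp⟩ : Fin (m + 1)).castSucc := rfl
        have h0 : (⟨(i.castSucc : ℕ), by have := i.2; simp; omega⟩ : Fin (m + 2)) =
          (⟨(i : ℕ), by omega⟩ : Fin (m + 1)).castSucc := rfl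
        rw [h1, h0, torusIdx_castSucc, torusIdx_castSucc, tauE_castSucc]
        exact ih (n + 1) i x.1

/-- The permutation of the indices of `V_{n+m}` induced by a permutation of the factors
of `E^m`. -/
def permIdx (m n : ℕ) : Equiv.Perm (Fin m) →* Equiv.Perm (Fin (level m n)) :=
  Equiv.Perm.viaEmbeddingHom ⟨torusIdx m n, torusIdx_injective m n⟩

theorem permIdx_swap (m n : ℕ) (i j : Fin m) :
    permIdx m n (Equiv.swap i j) = Equiv.swap (torusIdx m n i) (torusIdx m n j) := by
  ext k : 1
  rw [permIdx, Equiv.Perm.viaEmbeddingHom_apply]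
  by_cases hk : k ∈ Set.range (torusIdx m n)
  · obtain ⟨l, rfl⟩ := hk
    refine (Equiv.Perm.viaEmbedding_apply _ ⟨torusIdx m n, torusIdx_injective m n⟩ l).trans ?_
    exact (torusIdx_injective m n).map_swap i j l
  · rw [Equiv.Perm.viaEmbedding_apply_of_notMem _ _ _ hk, Equiv.swap_apply_of_ne_of_ne]
    · rintro rfl; exact hk ⟨i, rfl⟩
    · rintro rfl; exact hk ⟨j, rfl⟩

/-- An endomorphism of `E^m` represents a permutation `σ` if it acts on `E^m(V)_n`, as a subspace
of `V_{n+m}`, by the permutation matrix of `σ` times the sign of `σ`. -/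
def Represents (m : ℕ) (σ : Equiv.Perm (Fin m)) (f : End (Epow.{u, v} (F := F) m)) : Prop :=
  ∀ (V : StabObj.{u, v} F) (n : ℕ) (x : (((Epow m).obj V).V n).carrier),
    inclE V m n ((NatTrans.app f V).app n x) = ((Equiv.Perm.sign σ : ℤ) : F) •
      (V.V (level m n)).ρ (monomialGL (permIdx m n σ) fun _ => 1) (inclE V m n x)

theorem Represents.one (m : ℕ) : Represents.{u, v} (F := F) m 1 1 := fun V n x => by
  rw [map_one, map_one, monomialGL_one, map_one]
  simp
  rfl

theorem Represents.mul {m : ℕ} {σ σ' : Equiv.Perm (Fin m)}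
    {f f' : End (Epow.{u, v} (F := F) m)} (h : Represents m σ f) (h' : Represents m σ' f') :
    Represents m (σ * σ') (f * f') := fun V n x => by
  have h1 := h V n ((NatTrans.app f' V).app n x)
  rw [h' V n x, map_smul, smul_smul, ← Module.End.mul_apply, ← map_mul, monomialGL_mul, one_mul,
    ← map_mul] at h1
  rw [map_mul, Units.val_mul, Int.cast_mul]
  exact h1

theorem Represents.unique {m : ℕ} {σ : Equiv.Perm (Fin m)} {f f' : End (Epow.{u, v} (F := F) m)}
    (h : Represents m σ f) (h' : Represents m σ f') : f = f' := by
  refine NatTrans.ext (funext fun V => ?_)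
  apply hom_ext
  intro n
  apply Representation.IntertwiningMap.ext
  ext x
  exact inclE_injective V m n ((h V n x).trans (h' V n x).symm)

theorem represents_tauE (m : ℕ) (i : Fin (m - 1)) :
    Represents.{u, v} (F := F) m (simpleRefl m i) (tauE T m i) := fun V n x => by
  have hne : (⟨i, by omega⟩ : Fin m) ≠ ⟨i + 1, by omega⟩ := by simp
  rw [simpleRefl, Equiv.Perm.sign_swap hne, permIdx_swap]
  have h := inclE_tauE V m n i x
  -- the diagonal factor of the signed permutation matrix acts by `-1`, the sign of a transposition
  have h1 : monomialGL (Equiv.swap (torusIdx m n ⟨i, by omega⟩) (torusIdx m n ⟨i + 1, by omega⟩))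
        (scaleAt (torusIdx m n ⟨i, by omega⟩) (-1 : Fˣ)) =
      monomialGL (Equiv.swap (torusIdx m n ⟨i, by omega⟩) (torusIdx m n ⟨i + 1, by omega⟩))
        (fun _ => 1) * monomialGL 1 (scaleAt (torusIdx m n ⟨i, by omega⟩) (-1)) := by
    rw [monomialGL_mul, mul_one]
    simp only [one_mul]
  rw [h1, map_mul, Module.End.mul_apply, torusIdx_weight, map_smul] at h
  refine h.trans ?_
  simp

/-- The adjacent transpositions are represented by the endomorphisms `tauE`, and they generate the
symmetric group. -/
theorem exists_represents (m : ℕ) (σ : Equiv.Perm (Fin m)) :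
    ∃ f : End (Epow.{u, v} (F := F) m), Represents m σ f := by
  cases m with
  | zero => exact ⟨1, by rw [Subsingleton.elim σ 1]; exact Represents.one 0⟩
  | succ m =>
    have hσ : σ ∈ Submonoid.closure (Set.range fun i : Fin m => Equiv.swap i.castSucc i.succ) := by
      rw [Equiv.Perm.mclosure_swap_castSucc_succ]
      exact Submonoid.mem_top σ
    induction hσ using Submonoid.closure_induction with
    | mem σ h =>
      obtain ⟨i, rfl⟩ := h
      exact ⟨_, represents_tauE (m + 1) i⟩
    | one => exact ⟨1, Represents.one _⟩
    | mul σ σ' _ _ h h' =>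
      obtain ⟨f, hf⟩ := h
      obtain ⟨f', hf'⟩ := h'
      exact ⟨f * f', hf.mul hf'⟩

/-- The action of a permutation on `E^m`: the endomorphism which represents it, unique by
`Represents.unique`. -/
def permE (m : ℕ) (σ : Equiv.Perm (Fin m)) : End (Epow.{u, v} (F := F) m) :=
  (exists_represents m σ).choose

theorem represents_permE (m : ℕ) (σ : Equiv.Perm (Fin m)) :
    Represents.{u, v} (F := F) m σ (permE m σ) :=
  (exists_represents m σ).choose_spec

theorem permE_simpleRefl (m : ℕ) (i : Fin (m - 1)) :
    permE.{u, v} (F := F) m (simpleRefl m i) = tauE T m i :=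
  (represents_permE m _).unique (represents_tauE m i)

/-! ### The degenerate affine Hecke algebra acting on `E^m` -/

theorem exists_heckeHom [Infinite F] (m : ℕ) :
    ∃ φ : Hecke m →+* End (Epow.{u, v} (F := F) m),
      (∀ i : Fin m, φ (Hecke.y i) = yE X m i) ∧
        ∀ i : Fin (m - 1), φ (Hecke.tau i) = tauE T m i := by
  let gen : HeckeGen m → End (Epow.{u, v} (F := F) m) := fun
    | .y i => yE X m i
    | .w σ => permE m σ
  let ψ : FreeAlgebra ℤ (HeckeGen m) →+* End (Epow.{u, v} (F := F) m) :=
    (FreeAlgebra.lift ℤ gen).toRingHom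
  have hψ : ∀ a, ψ (FreeAlgebra.ι ℤ a) = gen a := fun a => FreeAlgebra.lift_ι_apply gen a
  have hrel : ∀ ⦃a b⦄, HeckeRel m a b → ψ a = ψ b := by
    intro a b h
    induction h with
    | y_comm i j => simp only [map_mul, hψ]; exact commute_yE X m i j
    | w_one => rw [hψ, map_one]; exact (represents_permE m 1).unique (Represents.one m)
    | w_mul σ σ' =>
      rw [map_mul, hψ, hψ, hψ]
      exact (represents_permE m (σ * σ')).unique
        ((represents_permE m σ).mul (represents_permE m σ'))
    | comm i j h h' =>
      rw [map_mul, map_mul, hψ, hψ]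
      change permE m _ * yE X m j = yE X m j * permE m _
      rw [permE_simpleRefl]
      exact commute_tauE_yE X T m i j h h'
    | exchange i =>
      rw [map_sub, map_mul, map_mul, hψ, hψ, hψ, map_one]
      change permE m _ * yE X m _ - yE X m _ * permE m _ = 1
      rw [permE_simpleRefl]
      exact tauE_mul_yE_sub X T X_T_relation m i
  refine ⟨RingQuot.lift ⟨ψ, hrel⟩, fun i => ?_, fun i => ?_⟩
  · rw [Hecke.y, RingQuot.lift_mkRingHom_apply, hψ]
  · rw [Hecke.tau, RingQuot.lift_mkRingHom_apply, hψ]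
    exact permE_simpleRefl m i

end StabObj

end PolyFock

end

theorem mainTheorem5 {F : Type u} [Field F] [IsAlgClosed F] (hF : ringChar F ≠ 2) :
    ∃ (X : (PolyFock.StabObj.E : PolyFock.StabObj.{u, v} F ⥤ PolyFock.StabObj.{u, v} F) ⟶
          PolyFock.StabObj.E)
      (T : (PolyFock.StabObj.E ⋙ PolyFock.StabObj.E :
          PolyFock.StabObj.{u, v} F ⥤ PolyFock.StabObj.{u, v} F) ⟶
          PolyFock.StabObj.E ⋙ PolyFock.StabObj.E),
      -- `X` acts on `E(V)_n = R_1 (V_{n+1})` by the operator `X_n`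
      (∀ (V : PolyFock.StabObj.{u, v} F) (n : ℕ) (x : ((V.V (n + 1)).R 1).carrier),
        (V.V (n + 1)).inclR 1 ((X.app V).app n x) =
          (V.V (n + 1)).opX ((V.V (n + 1)).inclR 1 x)) ∧
      -- `T` acts on `E²(V)_n = R_1 (R_1 (V_{n+2}))` by the matrix `s_{n+1}`
      (∀ (V : PolyFock.StabObj.{u, v} F) (n : ℕ) (x : (((V.V (n + 2)).R 1).R 1).carrier),
        (V.V (n + 2)).inclR 1 (((V.V (n + 2)).R 1).inclR 1 ((T.app V).app n x)) =
          (V.V (n + 2)).ρ (PolyFock.sElt n)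
            ((V.V (n + 2)).inclR 1 (((V.V (n + 2)).R 1).inclR 1 x))) ∧
      -- `T² = 1` and `T ∘ XE - EX ∘ T = 1`
      T ≫ T = 𝟙 _ ∧
      Functor.whiskerLeft PolyFock.StabObj.E X ≫ T -
        T ≫ Functor.whiskerRight X PolyFock.StabObj.E = 𝟙 _ ∧
      -- the degenerate affine Hecke algebra acts on `E^m`
      ∀ m : ℕ, ∃ φ : PolyFock.Hecke m →+* End (PolyFock.StabObj.Epow.{u, v} (F := F) m),
        (∀ i : Fin m, φ (PolyFock.Hecke.y i) = PolyFock.StabObj.yE X m i) ∧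
        (∀ i : Fin (m - 1), φ (PolyFock.Hecke.tau i) = PolyFock.StabObj.tauE T m i) := by
  have : Infinite F := inferInstance
  exact ⟨PolyFock.StabObj.X, PolyFock.StabObj.T, fun _ _ _ => rfl, fun _ _ _ => rfl,
    PolyFock.StabObj.T_comp_T, PolyFock.StabObj.X_T_relation, PolyFock.StabObj.exists_heckeHom⟩
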